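/- Length functions on a group $K$ are maps $L:K\to\mathbb N$ with $L(e)=0$, $L(k^{-1})=L(k)$ and $L(kk')\le L(k)+L(k')$. For $f:\mathbb N\to\mathbb R$, $(K,L)$ has $f$-decay if $\|\lambda(x)\|\le f(n)\|x\|_2$ for every $n\in\mathbb N$ and every $x\in\mathbb C[K]$ supported on $\{k: L(k)\le n\}$, where $\lambda$ is the left regular representation on $\ell^2(K)$ and $\|\cdot\|$ the operator norm. $(K,L)$ has RD if it has $f$-decay for some polynomial $f$, and SD if it has $f$-decay for some $f\ge 0$ with $f(n)^{1/n}\to 1$; $K$ has RD (SD) if $(K,L)$ has RD (SD) for some length function $L$. Two length functions $L_1,L_2$ on $K$ are $g$-distorted if $L_1(k)\le g(L_2(k))$ and $L_2(k)\le g(L_1(k))$ for all $k\in K$. Let $G,H$ be groups with length functions $L_G,L_H$ and let $A$ be a common subgroup. For $k\in G*_AH$ let $L^U(k)$ be the minimum of $\sum_i L_i(k_i)$ over all factorizations $k=\prod_i k_i$ with $k_i\in G\cup H$, where $L_i=L_G$ if $k_i\in G\setminus A$, $L_i=L_H$ if $k_i\in H\setminus A$, and $L_i$ is freely chosen among $L_G,L_H$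 if $k_i\in A$. Then $L^U$ is a length function on $G*_AH$. Let $j:\mathbb N\to\mathbb R$, and suppose that $(L_G|_A,L_H|_A)$ are $(x+j(x))$-distorted on $A$. Consider the condition (P) elements of $G$ or $H$ of length zero lie in $A$, and $L_G(a)=0\iff L_H(a)=0$ for $a\in A$ (for example, $L_G$ and $L_H$ vanish only at the identity). (0) Suppose that (P) holds, that $j$ is nondecreasing and that $j(x)/x$ is nonincreasing on $x\ge1$. If $(G,L_G)$ and $(H,L_H)$ both have $f$-decay, then $(G*_AH,L^U)$ has $\tilde f\circ\bigl(x\exp(j(x))\bigr)$-decay, where $\tilde f(x)=(2x+1)^{7/2}f(2x)$ and $f$ is evaluated at a real number by rounding it down. (1) If $j(x)=O(\ln x)$ and $(G,L_G)$, $(H,L_H)$ have RD, then $G*_AH$ has RD. (2) If $j(x)=o(x)$ and $(G,L_G)$, $(H,L_H)$ have RD, then $G*_AH$ has SD. (3) If $j(x)=O(1)$ and $(G,L_G)$, $(H,L_H)$ have SD, then $G*_AH$ has SD. In (1)-(3) no further condition is placed on $j$; if moreover (P) holds, then $L^U$ is a length function witnessing the conclusion. -/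

import Mathlib

open Filter Topology Asymptotics

universe u v

/-! ## Length functions and distortion -/

/-- An (integer valued) length function on a group. No properness is demanded, and nontrivial
elements may have length zero. -/
structure IsLengthFunction {K : Type*} [Group K] (l : K → ℕ) : Prop where
  one : l 1 = 0
  inv : ∀ k, l k⁻¹ = l k
  mul_le : ∀ k₁ k₂, l (k₁ * k₂) ≤ l k₁ + l k₂

/-- Two length functions are `g`-distorted if each is bounded by `g` of the other. -/
def IsDistorted {K : Type*} (g : ℕ → ℝ) (l₁ l₂ : K → ℕ) : Prop :=
  ∀ k, (l₁ k : ℝ) ≤ g (l₂ k) ∧ (l₂ k : ℝ) ≤ g (l₁ k)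

/-! ## The left regular representation and decay -/

section Regular

variable {K : Type*} [Group K]

theorem memlp_leftTranslate (g : K) (ξ : lp (fun _ : K => ℂ) 2) :
    Memℓp (fun k => ξ (g⁻¹ * k)) 2 := by
  have h := (memℓp_gen_iff (p := 2) (by norm_num)).1 (lp.memℓp ξ)
  refine (memℓp_gen_iff (p := 2) (by norm_num)).2 ?_
  exact (Equiv.mulLeft g⁻¹).summable_iff.2 h

/-- The unitary `λ(g)` on `ℓ²(K)`, `(λ(g) ξ)(k) = ξ(g⁻¹ k)`, as a linear isometry. -/
noncomputable def leftTranslate (g : K) :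
    lp (fun _ : K => ℂ) 2 →ₗᵢ[ℂ] lp (fun _ : K => ℂ) 2 where
  toFun ξ := ⟨fun k => ξ (g⁻¹ * k), memlp_leftTranslate g ξ⟩
  map_add' _ _ := rfl
  map_smul' _ _ := rfl
  norm_map' ξ := by
    rw [lp.norm_eq_tsum_rpow (p := 2) (by norm_num), lp.norm_eq_tsum_rpow (p := 2) (by norm_num)]
    congr 1
    exact (Equiv.mulLeft g⁻¹).tsum_eq (fun k => ‖ξ k‖ ^ (2 : ENNReal).toReal)

/-- The operator `λ(x) = ∑ g, x(g) λ(g)` on `ℓ²(K)` given by an element `x` of the group ring. -/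
noncomputable def regularRep (x : MonoidAlgebra ℂ K) :
    lp (fun _ : K => ℂ) 2 →L[ℂ] lp (fun _ : K => ℂ) 2 :=
  ∑ g ∈ x.coeff.support, x.coeff g • (leftTranslate g).toContinuousLinearMap

/-- The `2`-norm of an element of the group ring. -/
noncomputable def twoNorm (x : MonoidAlgebra ℂ K) : ℝ :=
  Real.sqrt (∑ g ∈ x.coeff.support, ‖x.coeff g‖ ^ 2)

/-- `(K, l)` has `f`-decay: `‖λ(x)‖ ≤ f(n) ‖x‖₂` for `x` supported on the `l`-ball of radius `n`. -/
def HasDecay (l : K → ℕ) (f : ℕ → ℝ) : Prop :=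
  ∀ (n : ℕ) (x : MonoidAlgebra ℂ K), (∀ g ∈ x.coeff.support, l g ≤ n) →
    ‖regularRep x‖ ≤ f n * twoNorm x

/-- A function `f : ℕ → ℝ≥0` is subexponential if `f(n)^(1/n) → 1`. -/
def IsSubexponential (f : ℕ → ℝ) : Prop :=
  (∀ n, 0 ≤ f n) ∧ Tendsto (fun n : ℕ => f n ^ (1 / (n : ℝ))) atTop (𝓝 1)

/-- Rapid decay with respect to a given length function. -/
def HasRDWith (l : K → ℕ) : Prop :=
  ∃ p : Polynomial ℝ, HasDecay l (fun n => p.eval (n : ℝ))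

/-- Subexponential decay with respect to a given length function. -/
def HasSDWith (l : K → ℕ) : Prop :=
  ∃ f : ℕ → ℝ, IsSubexponential f ∧ HasDecay l f

variable (K) in
/-- Property RD: rapid decay with respect to some length function. -/
def HasRD : Prop := ∃ l : K → ℕ, IsLengthFunction l ∧ HasRDWith l

variable (K) in
/-- Property SD: subexponential decay with respect to some length function. -/
def HasSD : Prop := ∃ l : K → ℕ, IsLengthFunction l ∧ HasSDWith l

end Regular

/-! ## The amalgamated free product -/

/-- The family consisting of the two groups `G` and `H`. -/
def GroupPair (G H : Type u) : Bool → Type u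
  | false => G
  | true => H

instance GroupPair.instGroup (G H : Type u) [Group G] [Group H] : ∀ b, Group (GroupPair G H b)
  | false => inferInstanceAs (Group G)
  | true => inferInstanceAs (Group H)

section Amalgam

variable {A : Type v} {G H : Type u} [Group A] [Group G] [Group H]

/-- The two embeddings of the amalgam, as a family. -/
def pairHom (iG : A →* G) (iH : A →* H) : ∀ b, A →* GroupPair G H b
  | false => iG
  | true => iH

/-- The amalgamated free product `G *_A H`. -/
abbrev Amalgam (iG : A →* G) (iH : A →* H) : Type _ := Monoid.PushoutI (pairHom iG iH)

/-- The canonical map `G → G *_A H`. -/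
def Amalgam.inG (iG : A →* G) (iH : A →* H) : G →* Amalgam iG iH :=
  Monoid.PushoutI.of (φ := pairHom iG iH) false

/-- The canonical map `H → G *_A H`. -/
def Amalgam.inH (iG : A →* G) (iH : A →* H) : H →* Amalgam iG iH :=
  Monoid.PushoutI.of (φ := pairHom iG iH) true

/-- The product in `G *_A H` of a word with letters in `G` and `H`. -/
def wordProd (iG : A →* G) (iH : A →* H) (w : List (G ⊕ H)) : Amalgam iG iH :=
  (w.map (Sum.elim (Amalgam.inG iG iH) (Amalgam.inH iG iH))).prod

/-- The total length of a word. An element of `A` may appear as a letter of `G`, measured by `LG`,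
or as a letter of `H`, measured by `LH`. -/
def wordLength (LG : G → ℕ) (LH : H → ℕ) (w : List (G ⊕ H)) : ℕ :=
  (w.map (Sum.elim LG LH)).sum

/-- The universal length function `L^U` on `G *_A H`: the minimal total length of a word
representing the given element (every element is represented, see `exists_wordProd_eq`). -/
noncomputable def universalLength (iG : A →* G) (iH : A →* H) (LG : G → ℕ) (LH : H → ℕ)
    (k : Amalgam iG iH) : ℕ :=
  sInf {n | ∃ w : List (G ⊕ H), wordProd iG iH w = k ∧ wordLength LG LH w = n}

theorem exists_wordProd_eq (iG : A →* G) (iH : A →* H) (k : Amalgam iG iH) :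
    ∃ w : List (G ⊕ H), wordProd iG iH w = k := by
  induction k using Monoid.PushoutI.induction_on with
  | of b g =>
    cases b with
    | false => exact ⟨[Sum.inl g], by simp [wordProd]; rfl⟩
    | true => exact ⟨[Sum.inr g], by simp [wordProd]; rfl⟩
  | base a =>
    refine ⟨[Sum.inl (iG a)], ?_⟩
    rw [← Monoid.PushoutI.of_apply_eq_base (pairHom iG iH) false a]
    simp [wordProd, Amalgam.inG, pairHom]
    rfl
  | mul x y hx hy =>
    obtain ⟨w, rfl⟩ := hx
    obtain ⟨w', rfl⟩ := hy
    exact ⟨w ++ w', by simp [wordProd]⟩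

/-- Elements of length zero lie in the amalgam, and on the amalgam the two length functions have
the same zeros. This holds in particular if `LG` and `LH` vanish only at the identity. -/
structure ZerosInAmalgam (iG : A →* G) (iH : A →* H) (LG : G → ℕ) (LH : H → ℕ) : Prop where
  left : ∀ g, LG g = 0 → ∃ a, iG a = g
  right : ∀ h, LH h = 0 → ∃ a, iH a = h
  iff : ∀ a, LG (iG a) = 0 ↔ LH (iH a) = 0

end Amalgam

/-- `f̃(x) = (2x+1)^(7/2) f(2x)`, for real `x ≥ 0`; a function of an integer radius is evaluated at
a real radius by rounding down (balls for integer valued lengths do not change thereby). -/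
noncomputable def decayTilde (f : ℕ → ℝ) (x : ℝ) : ℝ :=
  (2 * x + 1) ^ (7 / 2 : ℝ) * f ⌊2 * x⌋₊

/-! Decay amounts to a convolution inequality for nonnegative functions: ‖X ∗ Y‖₂ ≤ C‖X‖₂‖Y‖₂
whenever X is finitely supported in the ball. Elements of the amalgam have alternating normal forms,
unique up to inserting elements of A between the letters.

In a factorization z = u · (u⁻¹z), compare normal forms (`exists_divergence`): u starts with a
prefix of z, ends with the inverse of a prefix of u⁻¹z, and at most one letter lies between. Replace
both prefixes by representatives of their cosets modulo A that depend only on the coset. For fixed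
numbers k, k' of prefix letters this gives u = αgβ⁻¹ with α determined by z, β by u⁻¹z, and g in one
of the two factors. Cauchy–Schwarz over β and disjointness over α (`ConvolutionBound.marked`) reduce
the estimate to convolution by g, to which the decay of the factor applies. The number of triples
(type, k, k') enters as a polynomial factor.

It remains to bound the length of g. Measuring an element of A by the other length function, a
conversion, costs a factor 1 + c with c = j(n)/n. Rewriting a word of length at most n as a normal
form with m letters takes at most n - m conversions, since each letter kept and each conversion is
paid for by a separate unit of length (`IsLengthPair.hasShortForm`). Replacing the prefixes by
representatives of minimal length doubles the length and pushes elements of A through the normal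
form, which takes at most m further conversions (`HasShortForm.exists_markers`). So g has length at
most 2n(1 + c)ⁿ ≤ 2n exp(j(n)).

For the special cases j is replaced by a regular majorant: k(1 + ln n), an infimum of affine
functions, or a constant. Adding one to the lengths of nontrivial elements forces the condition on
zeros without harming decay or distortion (`hasDecay_positive_and`). -/

open scoped ENNReal

/-! ## Square sums with values in `[0, ∞]` -/

section SquareSums

/-- The `ℓ²`-norm, possibly infinite, of a function with values in `[0, ∞]`. -/
noncomputable def twoNormENN {ι : Type*} (f : ι → ℝ≥0∞) : ℝ≥0∞ :=
  (∑' i, f i ^ 2) ^ (1 / 2 : ℝ)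

theorem ennreal_rpow_half_sq (a : ℝ≥0∞) : (a ^ (1 / 2 : ℝ)) ^ 2 = a := by
  rw [← ENNReal.rpow_natCast, ← ENNReal.rpow_mul]; norm_num

theorem twoNormENN_sq {ι : Type*} (f : ι → ℝ≥0∞) : twoNormENN f ^ 2 = ∑' i, f i ^ 2 :=
  ennreal_rpow_half_sq _

theorem tsum_mul_le_twoNormENN {ι : Type*} (f g : ι → ℝ≥0∞) :
    ∑' i, f i * g i ≤ twoNormENN f * twoNormENN g := by
  rw [ENNReal.tsum_eq_iSup_sum]
  refine iSup_le fun s => ?_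
  have h := ENNReal.inner_le_Lp_mul_Lq s f g (p := 2) (q := 2) Real.HolderConjugate.two_two
  refine h.trans ?_
  simp only [ENNReal.rpow_ofNat]
  unfold twoNormENN
  gcongr <;> exact ENNReal.sum_le_tsum s

theorem tsum_mul_sq_le {ι : Type*} (f g : ι → ℝ≥0∞) :
    (∑' i, f i * g i) ^ 2 ≤ (∑' i, f i ^ 2) * ∑' i, g i ^ 2 := by
  rw [← twoNormENN_sq, ← twoNormENN_sq, ← mul_pow]
  gcongr
  exact tsum_mul_le_twoNormENN f g

/-- Minkowski's inequality for ℓ²: expanding the square and exchanging sums leaves Cauchy–Schwarz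
for each pair of summands. -/
theorem tsum_tsum_sq_le {ι κ : Type*} (F : ι → κ → ℝ≥0∞) :
    ∑' c, (∑' i, F i c) ^ 2 ≤ (∑' i, twoNormENN (F i)) ^ 2 := by
  have h : ∀ c, (∑' i, F i c) ^ 2 = ∑' i, ∑' i', F i c * F i' c := fun c => by
    simp only [sq, ENNReal.tsum_mul_left, ENNReal.tsum_mul_right]
  calc ∑' c, (∑' i, F i c) ^ 2 = ∑' i, ∑' i', ∑' c, F i c * F i' c := by
        simp only [h]
        rw [ENNReal.tsum_comm]
        exact tsum_congr fun i => ENNReal.tsum_comm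
    _ ≤ ∑' i, ∑' i', twoNormENN (F i) * twoNormENN (F i') :=
        ENNReal.tsum_le_tsum fun i => ENNReal.tsum_le_tsum fun i' => tsum_mul_le_twoNormENN _ _
    _ = (∑' i, twoNormENN (F i)) ^ 2 := by
        simp only [sq, ENNReal.tsum_mul_left, ENNReal.tsum_mul_right]

theorem tsum_finset_sum_sq_le {ι κ : Type*} (s : Finset ι) (F : ι → κ → ℝ≥0∞) {M : ℝ≥0∞}
    (h : ∀ i ∈ s, ∑' c, F i c ^ 2 ≤ M) :
    ∑' c, (∑ i ∈ s, F i c) ^ 2 ≤ (s.card : ℝ≥0∞) ^ 2 * M := by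
  calc ∑' c, (∑ i ∈ s, F i c) ^ 2 ≤ ∑' c, (s.card : ℝ≥0∞) * ∑ i ∈ s, F i c ^ 2 := by
        refine ENNReal.tsum_le_tsum fun c => ?_
        have := ENNReal.rpow_sum_le_const_mul_sum_rpow s (fun i => F i c) (p := 2) (by norm_num)
        norm_num at this
        exact this
    _ = (s.card : ℝ≥0∞) * ∑ i ∈ s, ∑' c, F i c ^ 2 := by
        rw [ENNReal.tsum_mul_left, Summable.tsum_finsetSum (fun _ _ => ENNReal.summable)]
    _ ≤ (s.card : ℝ≥0∞) * ∑ _i ∈ s, M := by gcongr with i hi; exact h i hi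
    _ = (s.card : ℝ≥0∞) ^ 2 * M := by rw [Finset.sum_const, nsmul_eq_mul, sq, mul_assoc]

end SquareSums

/-! ## Convolution bounds -/

section Convolution

variable {Γ : Type*} [Group Γ]

/-- Convolution on the left by a finitely supported function `X ≥ 0` with support in `B` is bounded
on `ℓ²(Γ)` by `C ‖X‖₂`. -/
def ConvolutionBound (B : Set Γ) (C : ℝ≥0∞) : Prop :=
  ∀ X Y : Γ → ℝ≥0∞, (Function.support X).Finite → (∀ g, X g ≠ ∞) → Function.support X ⊆ B →
    ∑' g, Y g ^ 2 ≠ ∞ →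
    ∑' c, (∑' g, X g * Y (g⁻¹ * c)) ^ 2 ≤ C ^ 2 * (∑' g, X g ^ 2) * ∑' g, Y g ^ 2

open Classical in
/-- The part of the convolution of `x` and `y` at `z` coming from those factorizations
`z = u (u⁻¹ z)` for which the markers `p` of `u` and `z` agree, the markers `q` of `u⁻¹` and
`u⁻¹ z` agree, and `u` lies between its markers in `B`. -/
noncomputable def markedConvolution (B : Set Γ) (p q : Γ → Γ) (x y : Γ → ℝ≥0∞) (z : Γ) : ℝ≥0∞ :=
  ∑' u, if p u = p z ∧ q u⁻¹ = q (u⁻¹ * z) ∧ (p u)⁻¹ * u * q u⁻¹ ∈ B then x u * y (u⁻¹ * z) else 0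

-- With α = p u and β = q u⁻¹, the function x splits into pieces indexed by (α, β) and y into pieces
-- indexed by β. The values at z with p z = α involve only the pieces with that α, so contributions
-- of different α are disjoint and only the sum over β needs Cauchy–Schwarz. No factor counting
-- markers arises.
open Classical in
theorem ConvolutionBound.marked {B : Set Γ} {C : ℝ≥0∞} (hB : ConvolutionBound B C) (p q : Γ → Γ)
    (x y : Γ → ℝ≥0∞) (hx : (Function.support x).Finite) (hx' : ∀ g, x g ≠ ∞)
    (hy : ∑' g, y g ^ 2 ≠ ∞) :
    ∑' z, markedConvolution B p q x y z ^ 2 ≤ C ^ 2 * (∑' g, x g ^ 2) * ∑' g, y g ^ 2 := by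
  -- Coordinates u = αgβ⁻¹ and u⁻¹z = βw, so that z = αgw: `X α β` and `Y β` are the pieces of x and
  -- y as functions of g ∈ B and w.
  set D : Γ → Γ → Γ → ℝ≥0∞ := fun α β u =>
    if p u = α ∧ q u⁻¹ = β ∧ α⁻¹ * u * β ∈ B then x u else 0 with hD
  set X : Γ → Γ → Γ → ℝ≥0∞ := fun α β g => D α β (α * g * β⁻¹) with hX
  set Y : Γ → Γ → ℝ≥0∞ := fun β w => if q (β * w) = β then y (β * w) else 0 with hY
  let e : Γ → Γ → Γ ≃ Γ := fun α β => (Equiv.mulLeft α).trans (Equiv.mulRight β⁻¹)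
  have he : ∀ α β g, e α β g = α * g * β⁻¹ := fun _ _ _ => rfl
  have hYsum : ∑' β, ∑' w, Y β w ^ 2 ≤ ∑' w, y w ^ 2 := by
    have h1 : ∀ β, ∑' w, Y β w ^ 2 = ∑' w, if β = q w then y w ^ 2 else 0 := fun β => by
      rw [← (Equiv.mulLeft β).tsum_eq (fun w => if β = q w then y w ^ 2 else 0)]
      refine tsum_congr fun w => ?_
      simp only [hY, Equiv.coe_mulLeft, eq_comm (a := β)]
      split_ifs <;> simp
    simp only [h1]
    rw [ENNReal.tsum_comm]
    exact ENNReal.tsum_le_tsum fun w => by rw [tsum_ite_eq]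
  have hXsum : ∑' α, ∑' β, ∑' g, X α β g ^ 2 ≤ ∑' u, x u ^ 2 := by
    have h1 : ∀ α β, ∑' g, X α β g ^ 2 = ∑' u, D α β u ^ 2 := fun α β => by
      rw [← (e α β).tsum_eq (fun u => D α β u ^ 2)]; rfl
    simp only [h1]
    have h2 : ∀ α β u, D α β u ^ 2 ≤ if β = q u⁻¹ then (if α = p u then x u ^ 2 else 0) else 0 := by
      intro α β u
      simp only [hD]
      by_cases h : p u = α ∧ q u⁻¹ = β ∧ α⁻¹ * u * β ∈ B
      · rw [if_pos h, if_pos h.2.1.symm, if_pos h.1.symm]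
      · rw [if_neg h]; simp
    calc ∑' α, ∑' β, ∑' u, D α β u ^ 2
        ≤ ∑' α, ∑' β, ∑' u, if β = q u⁻¹ then (if α = p u then x u ^ 2 else 0) else 0 := by
          gcongr; exact h2 _ _ _
      _ = ∑' α, ∑' u, ∑' β, if β = q u⁻¹ then (if α = p u then x u ^ 2 else 0) else 0 :=
          tsum_congr fun α => ENNReal.tsum_comm
      _ = ∑' α, ∑' u, if α = p u then x u ^ 2 else 0 := by simp only [tsum_ite_eq]
      _ = ∑' u, ∑' α, if α = p u then x u ^ 2 else 0 := ENNReal.tsum_comm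
      _ = ∑' u, x u ^ 2 := by simp only [tsum_ite_eq]
  have hXY : ∀ α β, twoNormENN (fun c => ∑' g, X α β g * Y β (g⁻¹ * c))
      ≤ C * (twoNormENN (X α β) * twoNormENN (Y β)) := by
    intro α β
    have hinj : Function.Injective (e α β) := (e α β).injective
    have := hB (X α β) (Y β) ?_ ?_ ?_
      (ne_top_of_le_ne_top hy ((ENNReal.le_tsum β).trans hYsum))
    · rw [← ENNReal.pow_le_pow_left_iff (n := 2) (by norm_num)]
      simp only [mul_pow, twoNormENN_sq]
      rw [← mul_assoc]; exact this
    · refine (hx.preimage hinj.injOn).subset fun g hg => ?_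
      simp only [Function.mem_support, Set.mem_preimage, he, hX, hD] at hg ⊢
      intro h0
      exact hg (by rw [h0]; simp)
    · intro g
      simp only [hX, hD]
      split_ifs
      · exact hx' _
      · simp
    · intro g hg
      simp only [Function.mem_support, hX, hD] at hg
      by_contra hgB
      refine hg (if_neg fun h => hgB ?_)
      have := h.2.2
      group at this
      exact this
  have hpt : ∀ α z, p z = α → markedConvolution B p q x y z
      ≤ ∑' β, ∑' g, X α β g * Y β (g⁻¹ * (α⁻¹ * z)) := by
    intro α z hz
    have h1 : ∀ β, ∑' g, X α β g * Y β (g⁻¹ * (α⁻¹ * z))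
        = ∑' u, D α β u * (if q (u⁻¹ * z) = β then y (u⁻¹ * z) else 0) := fun β => by
      rw [← (e α β).tsum_eq (fun u => D α β u * (if q (u⁻¹ * z) = β then y (u⁻¹ * z) else 0))]
      refine tsum_congr fun g => ?_
      have : β * (g⁻¹ * (α⁻¹ * z)) = (α * g * β⁻¹)⁻¹ * z := by group
      simp only [hX, hY, he, this]
    simp only [h1]
    rw [ENNReal.tsum_comm]
    refine ENNReal.tsum_le_tsum fun u => ?_
    split_ifs with h
    · refine le_trans ?_ (ENNReal.le_tsum (q u⁻¹))
      simp only [hD]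
      rw [if_pos ⟨h.1.trans hz, trivial, by rw [← hz, ← h.1]; exact h.2.2⟩, if_pos h.2.1.symm]
    · exact zero_le
  have hα : ∀ α, ∑' z, (if α = p z then markedConvolution B p q x y z ^ 2 else 0)
      ≤ C ^ 2 * (∑' β, ∑' g, X α β g ^ 2) * ∑' g, y g ^ 2 := by
    intro α
    calc ∑' z, (if α = p z then markedConvolution B p q x y z ^ 2 else 0)
        ≤ ∑' z, (∑' β, ∑' g, X α β g * Y β (g⁻¹ * (α⁻¹ * z))) ^ 2 := by
          refine ENNReal.tsum_le_tsum fun z => ?_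
          split_ifs with h
          · gcongr; exact hpt α z h.symm
          · exact zero_le
      _ = ∑' c, (∑' β, ∑' g, X α β g * Y β (g⁻¹ * c)) ^ 2 :=
          (Equiv.mulLeft α⁻¹).tsum_eq (fun c => (∑' β, ∑' g, X α β g * Y β (g⁻¹ * c)) ^ 2)
      _ ≤ (∑' β, twoNormENN (fun c => ∑' g, X α β g * Y β (g⁻¹ * c))) ^ 2 := tsum_tsum_sq_le _
      _ ≤ (∑' β, C * (twoNormENN (X α β) * twoNormENN (Y β))) ^ 2 := by
          gcongr; exact hXY _ _
      _ = C ^ 2 * (∑' β, twoNormENN (X α β) * twoNormENN (Y β)) ^ 2 := by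
          rw [ENNReal.tsum_mul_left, mul_pow]
      _ ≤ C ^ 2 * ((∑' β, twoNormENN (X α β) ^ 2) * ∑' β, twoNormENN (Y β) ^ 2) := by
          gcongr; exact tsum_mul_sq_le _ _
      _ ≤ C ^ 2 * (∑' β, ∑' g, X α β g ^ 2) * ∑' g, y g ^ 2 := by
          simp only [twoNormENN_sq]
          rw [← mul_assoc]
          gcongr
  calc ∑' z, markedConvolution B p q x y z ^ 2
      = ∑' z, ∑' α, (if α = p z then markedConvolution B p q x y z ^ 2 else 0) := by
        simp only [tsum_ite_eq]
    _ = ∑' α, ∑' z, (if α = p z then markedConvolution B p q x y z ^ 2 else 0) := ENNReal.tsum_comm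
    _ ≤ ∑' α, C ^ 2 * (∑' β, ∑' g, X α β g ^ 2) * ∑' g, y g ^ 2 := ENNReal.tsum_le_tsum hα
    _ = C ^ 2 * (∑' α, ∑' β, ∑' g, X α β g ^ 2) * ∑' g, y g ^ 2 := by
        rw [ENNReal.tsum_mul_right, ENNReal.tsum_mul_left]
    _ ≤ C ^ 2 * (∑' u, x u ^ 2) * ∑' g, y g ^ 2 := by gcongr

/-- If every factorization `z = u (u⁻¹ z)` with `u ∈ U` is marked by one of finitely many pairs of
markers, then `U` satisfies a convolution bound. -/
theorem ConvolutionBound.of_markers {ι : Type*} (s : Finset ι) (B : ι → Set Γ) (p q : ι → Γ → Γ)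
    {C : ℝ≥0∞} (hB : ∀ i ∈ s, ConvolutionBound (B i) C) {U : Set Γ}
    (hU : ∀ u ∈ U, ∀ z, ∃ i ∈ s, p i u = p i z ∧ q i u⁻¹ = q i (u⁻¹ * z) ∧
      (p i u)⁻¹ * u * q i u⁻¹ ∈ B i) :
    ConvolutionBound U (s.card * C) := by
  classical
  intro x y hx hx' hxU hy
  calc ∑' z, (∑' u, x u * y (u⁻¹ * z)) ^ 2
      ≤ ∑' z, (∑ i ∈ s, markedConvolution (B i) (p i) (q i) x y z) ^ 2 := by
        refine ENNReal.tsum_le_tsum fun z => ?_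
        gcongr
        unfold markedConvolution
        rw [← Summable.tsum_finsetSum (fun _ _ => ENNReal.summable)]
        refine ENNReal.tsum_le_tsum fun u => ?_
        by_cases hu : x u = 0
        · simp [hu]
        obtain ⟨i, hi, h⟩ := hU u (hxU hu) z
        refine le_trans ?_ (Finset.single_le_sum (fun _ _ => zero_le) hi)
        rw [if_pos h]
    _ ≤ (s.card : ℝ≥0∞) ^ 2 * (C ^ 2 * (∑' g, x g ^ 2) * ∑' g, y g ^ 2) :=
        tsum_finset_sum_sq_le s _ fun i hi => (hB i hi).marked (p i) (q i) x y hx hx' hy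
    _ = (s.card * C) ^ 2 * (∑' g, x g ^ 2) * ∑' g, y g ^ 2 := by ring

end Convolution

/-! ## Decay as a convolution bound -/

section DecayConvolution

theorem twoNorm_nonneg {K : Type*} (x : MonoidAlgebra ℂ K) : 0 ≤ twoNorm x := Real.sqrt_nonneg _

theorem tsum_enorm_sq_eq {K : Type*} (ξ : lp (fun _ : K => ℂ) 2) : ∑' k, ‖ξ k‖ₑ ^ 2 = ‖ξ‖ₑ ^ 2 := by
  have h2 : (2 : ℝ≥0∞).toReal = (2 : ℕ) := by norm_num
  have hs : Summable fun k => ‖ξ k‖ ^ 2 := by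
    have := (memℓp_gen_iff (p := 2) (by norm_num)).1 (lp.memℓp ξ)
    simpa only [h2, Real.rpow_natCast] using this
  have hn : ‖ξ‖ ^ 2 = ∑' k, ‖ξ k‖ ^ 2 := by
    have := lp.norm_rpow_eq_tsum (p := 2) (by norm_num) ξ
    simpa only [h2, Real.rpow_natCast] using this
  rw [← ofReal_norm, ← ENNReal.ofReal_pow (norm_nonneg _), hn,
    ENNReal.ofReal_tsum_of_nonneg (fun _ => sq_nonneg _) hs]
  refine tsum_congr fun k => ?_
  rw [← ofReal_norm, ENNReal.ofReal_pow (norm_nonneg _)]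

theorem tsum_enorm_coeff_sq_eq {K : Type*} (x : MonoidAlgebra ℂ K) :
    ∑' g, ‖x.coeff g‖ₑ ^ 2 = ENNReal.ofReal (twoNorm x) ^ 2 := by
  rw [← ENNReal.ofReal_pow (twoNorm_nonneg x), twoNorm, Real.sq_sqrt (by positivity),
    ENNReal.ofReal_sum_of_nonneg (fun _ _ => sq_nonneg _), tsum_eq_sum (s := x.coeff.support)]
  · refine Finset.sum_congr rfl fun g _ => ?_
    rw [← ofReal_norm, ENNReal.ofReal_pow (norm_nonneg _)]
  · intro g hg
    simp [Finsupp.notMem_support_iff.1 hg]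

variable {K : Type*} [Group K]

theorem regularRep_apply (x : MonoidAlgebra ℂ K) (ξ : lp (fun _ : K => ℂ) 2) (k : K) :
    regularRep x ξ k = ∑ g ∈ x.coeff.support, x.coeff g * ξ (g⁻¹ * k) := by
  have h1 : regularRep x ξ
      = ∑ g ∈ x.coeff.support, x.coeff g • leftTranslate g ξ := by
    simp [regularRep]
  rw [h1, lp.coeFn_sum, Finset.sum_apply]
  rfl

/-- Test on the unit mass at the identity, whose support lies in every ball. -/
theorem HasDecay.nonneg {l : K → ℕ} {f : ℕ → ℝ} (hl : l 1 = 0) (h : HasDecay l f) (n : ℕ) :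
    0 ≤ f n := by
  have hs : (MonoidAlgebra.single (1 : K) (1 : ℂ)).coeff.support = {1} := by
    ext g; simp [eq_comm]
  have h1 := h n (MonoidAlgebra.single 1 1) (fun g hg => by
    rw [hs, Finset.mem_singleton] at hg
    simp [hg, hl])
  have h2 : twoNorm (MonoidAlgebra.single (1 : K) (1 : ℂ)) = 1 := by
    rw [twoNorm, hs]; simp
  rw [h2, mul_one] at h1
  exact (norm_nonneg _).trans h1

/-- A nonnegative finitely supported X is a group ring element and a square-summable Y a vector of
ℓ², so X ∗ Y is literally λ(X)Y. -/
theorem HasDecay.convolutionBound {l : K → ℕ} {f : ℕ → ℝ} (h : HasDecay l f) (n : ℕ) :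
    ConvolutionBound {g | l g ≤ n} (ENNReal.ofReal (f n)) := by
  intro X Y hX hX' hXn hY
  have hYtop : ∀ g, Y g ≠ ∞ := fun g hg => by
    refine hY (top_le_iff.1 (le_trans ?_ (ENNReal.le_tsum g)))
    simp [hg]
  let x : MonoidAlgebra ℂ K := MonoidAlgebra.ofCoeff (Finsupp.ofSupportFinite
    (fun g => ((X g).toReal : ℂ)) (hX.subset fun g hg => by
      simp only [Function.mem_support] at hg ⊢
      intro h0; exact hg (by simp [h0])))
  have hx : ∀ g, x.coeff g = ((X g).toReal : ℂ) := fun _ => rfl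
  have henX : ∀ g, ‖((X g).toReal : ℂ)‖ₑ = X g := fun g => by
    rw [← ofReal_norm, Complex.norm_real, Real.norm_of_nonneg ENNReal.toReal_nonneg,
      ENNReal.ofReal_toReal (hX' g)]
  have henY : ∀ g, ‖((Y g).toReal : ℂ)‖ₑ = Y g := fun g => by
    rw [← ofReal_norm, Complex.norm_real, Real.norm_of_nonneg ENNReal.toReal_nonneg,
      ENNReal.ofReal_toReal (hYtop g)]
  let ξ : lp (fun _ : K => ℂ) 2 := ⟨fun g => ((Y g).toReal : ℂ), by
    refine (memℓp_gen_iff (p := 2) (by norm_num)).2 ?_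
    have h2 : (2 : ℝ≥0∞).toReal = (2 : ℕ) := by norm_num
    simp only [h2, Real.rpow_natCast, Complex.norm_real, Real.norm_of_nonneg ENNReal.toReal_nonneg,
      ← ENNReal.toReal_pow]
    exact ENNReal.summable_toReal hY⟩
  have hξ : ∀ g, ξ g = ((Y g).toReal : ℂ) := fun _ => rfl
  have hsupp : ∀ g ∈ x.coeff.support, l g ≤ n := fun g hg => hXn (by
    simp only [Function.mem_support]
    intro h0
    rw [Finsupp.mem_support_iff, hx, h0] at hg
    simp at hg)
  have hc : ∀ c, ∑' g, X g * Y (g⁻¹ * c) = ‖regularRep x ξ c‖ₑ := by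
    intro c
    rw [regularRep_apply, tsum_eq_sum (s := x.coeff.support)]
    · have : ∀ g ∈ x.coeff.support, x.coeff g * ξ (g⁻¹ * c)
          = (((X g * Y (g⁻¹ * c)).toReal : ℝ) : ℂ) := fun g _ => by
        rw [hx, hξ, ENNReal.toReal_mul]; push_cast; rfl
      rw [Finset.sum_congr rfl this, ← Complex.ofReal_sum, ← ENNReal.toReal_sum, ← ofReal_norm,
        Complex.norm_real, Real.norm_of_nonneg ENNReal.toReal_nonneg, ENNReal.ofReal_toReal]
      · exact ENNReal.sum_ne_top.2 fun g _ => ENNReal.mul_ne_top (hX' _) (hYtop _)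
      · exact fun g _ => ENNReal.mul_ne_top (hX' _) (hYtop _)
    · intro g hg
      have := Finsupp.notMem_support_iff.1 hg
      rw [hx] at this
      rw [← henX, this]; simp
  have hfinal : ‖regularRep x ξ‖ₑ ≤ ENNReal.ofReal (f n) * ENNReal.ofReal (twoNorm x) * ‖ξ‖ₑ := by
    have h1 := (regularRep x).le_of_opNorm_le (h n x hsupp) ξ
    rw [← ofReal_norm, ← ofReal_norm]
    refine (ENNReal.ofReal_le_ofReal h1).trans ?_
    rw [ENNReal.ofReal_mul' (norm_nonneg _), ENNReal.ofReal_mul' (twoNorm_nonneg _)]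
  calc ∑' c, (∑' g, X g * Y (g⁻¹ * c)) ^ 2 = ‖regularRep x ξ‖ₑ ^ 2 := by
        simp only [hc]; exact tsum_enorm_sq_eq _
    _ ≤ (ENNReal.ofReal (f n) * ENNReal.ofReal (twoNorm x) * ‖ξ‖ₑ) ^ 2 := by gcongr
    _ = ENNReal.ofReal (f n) ^ 2 * (∑' g, X g ^ 2) * ∑' g, Y g ^ 2 := by
        rw [mul_pow, mul_pow, ← tsum_enorm_coeff_sq_eq, ← tsum_enorm_sq_eq]
        simp only [hx, hξ, henX, henY]

/-- Passing to absolute values dominates λ(x)ξ pointwise by |x| ∗ |ξ| and leaves both 2-norms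
unchanged. -/
theorem ConvolutionBound.norm_regularRep_le {B : Set K} {C : ℝ}
    (h : ConvolutionBound B (ENNReal.ofReal C)) (hC : 0 ≤ C) (x : MonoidAlgebra ℂ K)
    (hx : ∀ g ∈ x.coeff.support, g ∈ B) : ‖regularRep x‖ ≤ C * twoNorm x := by
  refine ContinuousLinearMap.opNorm_le_bound _ (mul_nonneg hC (twoNorm_nonneg _)) fun ξ => ?_
  have hξ : ∑' k, ‖ξ k‖ₑ ^ 2 ≠ ∞ := by
    rw [tsum_enorm_sq_eq]; exact ENNReal.pow_ne_top enorm_ne_top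
  have hsup : Function.support (fun g => ‖x.coeff g‖ₑ) = x.coeff.support := by
    ext g; simp
  have h1 := h (fun g => ‖x.coeff g‖ₑ) (fun g => ‖ξ g‖ₑ)
    (by rw [hsup]; exact Finset.finite_toSet _)
    (fun _ => enorm_ne_top) (by rw [hsup]; exact fun g hg => hx g hg) hξ
  have h2 : ‖regularRep x ξ‖ₑ ^ 2 ≤ (ENNReal.ofReal (C * twoNorm x * ‖ξ‖)) ^ 2 := by
    rw [← tsum_enorm_sq_eq]
    calc ∑' k, ‖regularRep x ξ k‖ₑ ^ 2
        ≤ ∑' k, (∑' g, ‖x.coeff g‖ₑ * ‖ξ (g⁻¹ * k)‖ₑ) ^ 2 := by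
          gcongr with k
          rw [regularRep_apply]
          refine (enorm_sum_le _ _).trans ?_
          simp only [enorm_mul]
          exact ENNReal.sum_le_tsum _
      _ ≤ _ := h1
      _ = _ := by
          rw [tsum_enorm_coeff_sq_eq, tsum_enorm_sq_eq, ENNReal.ofReal_mul' (norm_nonneg _),
            ENNReal.ofReal_mul' (twoNorm_nonneg _), ofReal_norm, mul_pow, mul_pow]
  rw [ENNReal.pow_le_pow_left_iff (by norm_num), ← ofReal_norm] at h2
  exact (ENNReal.ofReal_le_ofReal_iff
    (mul_nonneg (mul_nonneg hC (twoNorm_nonneg _)) (norm_nonneg _))).1 h2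

/-- Γ is a disjoint union of right cosets φ(K)t, each preserved by left multiplication by φ(K).
Convolution by a function on φ(K) therefore acts on each coset as on K, and the squared norms add
up. -/
theorem ConvolutionBound.map {Γ : Type*} [Group Γ] {B : Set K} {C : ℝ≥0∞}
    (h : ConvolutionBound B C) (φ : K →* Γ) (hφ : Function.Injective φ) :
    ConvolutionBound (φ '' B) C := by
  intro X Y hX hX' hXB hY
  obtain ⟨T, hT, -⟩ := φ.range.exists_isComplement_right 1
  let e : T × K ≃ Γ := (Equiv.prodComm _ _).trans
    ((Equiv.prodCongr (MonoidHom.ofInjective hφ).toEquiv (Equiv.refl T)).trans hT.equiv.symm)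
  have he : ∀ t k, e (t, k) = φ k * t := fun _ _ => rfl
  have hrange : ∀ Z : Γ → ℝ≥0∞, ∑' g, X g * Z g = ∑' k, X (φ k) * Z (φ k) := fun Z => by
    refine (hφ.tsum_eq (f := fun g => X g * Z g) fun g hg => ?_).symm
    obtain ⟨k, -, rfl⟩ := hXB (fun h0 => hg (by simp [h0]) : g ∈ Function.support X)
    exact ⟨k, rfl⟩
  have hXK : ∑' k, X (φ k) ^ 2 = ∑' g, X g ^ 2 := by
    simpa only [sq] using (hrange X).symm
  have hYT : ∑' t : T, ∑' k, Y (φ k * t) ^ 2 = ∑' g, Y g ^ 2 := by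
    rw [← e.tsum_eq (fun g => Y g ^ 2), ← ENNReal.tsum_prod]
    rfl
  have hK : ∀ t : T, ∑' c, (∑' k, X (φ k) * Y (φ (k⁻¹ * c) * t)) ^ 2
      ≤ C ^ 2 * (∑' k, X (φ k) ^ 2) * ∑' k, Y (φ k * t) ^ 2 := fun t =>
    h (fun k => X (φ k)) (fun k => Y (φ k * t)) (hX.preimage hφ.injOn) (fun _ => hX' _)
      (fun k hk => by
        obtain ⟨k', hk', hkk⟩ := hXB (hk : φ k ∈ Function.support X)
        rwa [← hφ hkk])
      (ne_top_of_le_ne_top hY (by rw [← hYT]; exact ENNReal.le_tsum t))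
  calc ∑' c, (∑' g, X g * Y (g⁻¹ * c)) ^ 2
      = ∑' t : T, ∑' c, (∑' g, X g * Y (g⁻¹ * (φ c * t))) ^ 2 := by
        rw [← e.tsum_eq (fun c => (∑' g, X g * Y (g⁻¹ * c)) ^ 2), ← ENNReal.tsum_prod]
        rfl
    _ = ∑' t : T, ∑' c, (∑' k, X (φ k) * Y (φ (k⁻¹ * c) * t)) ^ 2 := by
        refine tsum_congr fun t => tsum_congr fun c => ?_
        rw [hrange fun g => Y (g⁻¹ * (φ c * t))]
        simp only [map_mul, map_inv, mul_assoc]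
    _ ≤ ∑' t : T, C ^ 2 * (∑' k, X (φ k) ^ 2) * ∑' k, Y (φ k * t) ^ 2 := ENNReal.tsum_le_tsum hK
    _ = C ^ 2 * (∑' g, X g ^ 2) * ∑' g, Y g ^ 2 := by rw [ENNReal.tsum_mul_left, hXK, hYT]

theorem ConvolutionBound.mono {B B' : Set K} {C : ℝ≥0∞} (h : ConvolutionBound B C)
    (hB : B' ⊆ B) : ConvolutionBound B' C :=
  fun X Y hX hX' hXB => h X Y hX hX' (hXB.trans hB)

end DecayConvolution

/-! ## Alternating words -/

section Alternating

variable {Γ : Type*} [Group Γ]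

/-- The letters of the list lie alternately in `S b \ A` and `S (!b) \ A`, beginning with `S b`. -/
def IsAlternating (A : Subgroup Γ) (S : Bool → Subgroup Γ) : Bool → List Γ → Prop
  | _, [] => True
  | b, g :: W => g ∈ S b ∧ g ∉ A ∧ IsAlternating A S (!b) W

/-- The total length of an alternating word that begins with a letter in `S b`. -/
def altLength (l : Bool → Γ → ℕ) : Bool → List Γ → ℕ
  | _, [] => 0
  | b, g :: W => l b g + altLength l (!b) W

/-- The subgroups `S false` and `S true` contain `A`, and no product of a nonempty alternating
word lies in `A`. -/
structure IsAmalgamPair (A : Subgroup Γ) (S : Bool → Subgroup Γ) : Prop where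
  le : ∀ b, A ≤ S b
  prod_notMem : ∀ b W, IsAlternating A S b W → W ≠ [] → W.prod ∉ A

variable {A : Subgroup Γ} {S : Bool → Subgroup Γ}

theorem IsAlternating.append {W₁ W₂ : List Γ} (l : Bool → Γ → ℕ) {b : Bool}
    (h : IsAlternating A S b (W₁ ++ W₂)) :
    IsAlternating A S b W₁ ∧ ∃ b', IsAlternating A S b' W₂ ∧
      altLength l b (W₁ ++ W₂) = altLength l b W₁ + altLength l b' W₂ := by
  induction W₁ generalizing b with
  | nil => exact ⟨trivial, b, h, by simp [altLength]⟩
  | cons g W ih =>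
    obtain ⟨h1, h2, h3⟩ := h
    obtain ⟨h4, b', h5, h6⟩ := ih h3
    exact ⟨⟨h1, h2, h4⟩, b', h5, by simp only [List.cons_append, altLength, h6, add_assoc]⟩

theorem IsAmalgamPair.smul_alternating (hA : IsAmalgamPair A S) {b : Bool} {g a : Γ} {W : List Γ}
    (h : IsAlternating A S b (g :: W)) (ha : a ∈ A) : IsAlternating A S b (a * g :: W) :=
  ⟨(S b).mul_mem (hA.le b ha) h.1, fun h' => h.2.1 ((A.mul_mem_cancel_left ha).1 h'), h.2.2⟩

/-- The inverse of an alternating word, prepended to an alternating word whose first letter is of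
the other type than the first letter of the given word. -/
theorem IsAlternating.exists_inv_append (l : Bool → Γ → ℕ) (hl : ∀ b, ∀ g ∈ S b, l b g⁻¹ = l b g)
    {W V : List Γ} {b : Bool} (hW : IsAlternating A S b W) (hV : IsAlternating A S (!b) V) :
    ∃ b' U, IsAlternating A S b' (U ++ V) ∧ U.length = W.length ∧ U.prod = W.prod⁻¹ ∧
      altLength l b' (U ++ V) = altLength l b W + altLength l (!b) V := by
  induction W generalizing b V with
  | nil => exact ⟨!b, [], hV, rfl, by simp, by simp [altLength]⟩
  | cons g W ih =>
    obtain ⟨h1, h2, h3⟩ := hW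
    obtain ⟨b', U, h4, h5, h6, h7⟩ := ih (V := g⁻¹ :: V) h3
      ⟨by simpa using h1, by simpa using h2, by simpa using hV⟩
    refine ⟨b', U ++ [g⁻¹], by simpa using h4, by simp [h5], by simp [h6], ?_⟩
    simp only [List.append_assoc, List.cons_append, List.nil_append, h7, altLength, Bool.not_not,
      hl b g h1]
    omega

theorem IsAmalgamPair.inv_mul_mul_notMem (hA : IsAmalgamPair A S) {W V : List Γ} {b : Bool}
    (hW : IsAlternating A S b W) (hV : IsAlternating A S (!b) V) (h : W ≠ [] ∨ V ≠ []) :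
    W.prod⁻¹ * V.prod ∉ A := by
  obtain ⟨b', U, h1, h2, h3, -⟩ := hW.exists_inv_append (fun _ _ => 0) (fun _ _ _ => rfl) hV
  rw [← h3, ← List.prod_append]
  refine hA.prod_notMem b' _ h1 fun h0 => ?_
  rw [List.append_eq_nil_iff] at h0
  rcases h with h | h
  · rw [h0.1, List.length_nil, eq_comm, List.length_eq_zero_iff] at h2
    exact h h2
  · exact h h0.2

/-- Two alternating words representing the same coset have the same shape, and their prefixes
represent the same cosets. -/
theorem IsAmalgamPair.eq_shape (hA : IsAmalgamPair A S) {W W' : List Γ} {b b' : Bool} {a : Γ}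
    (hW : IsAlternating A S b W) (hW' : IsAlternating A S b' W') (ha : a ∈ A)
    (h : W.prod⁻¹ * a * W'.prod ∈ A) :
    W.length = W'.length ∧ (W ≠ [] → b = b') ∧
      ∀ k, (W.take k).prod⁻¹ * a * (W'.take k).prod ∈ A := by
  induction W generalizing b b' W' a with
  | nil =>
    cases W' with
    | nil => simpa using ha
    | cons g V =>
      refine absurd ?_ (hA.prod_notMem b' _ hW' (by simp))
      simpa [A.mul_mem_cancel_left ha] using h
  | cons g V ih =>
    cases W' with
    | nil =>
      refine absurd ?_ (hA.prod_notMem b _ hW (by simp))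
      rw [List.prod_nil, mul_one, A.mul_mem_cancel_right ha, inv_mem_iff] at h
      exact h
    | cons g' V' =>
      have hW'' := hA.smul_alternating hW' ha
      -- If the first letters have different types, nothing cancels in W⁻¹aW', which is then a
      -- nonempty alternating product and not in A.
      by_cases hb : b' = !b
      · subst hb
        refine absurd ?_ (hA.inv_mul_mul_notMem hW hW'' (by simp))
        simpa only [List.prod_cons, mul_assoc] using h
      have hb' : b = b' := by revert hb; cases b <;> cases b' <;> simp
      subst hb'
      have hprod : V.prod⁻¹ * (g⁻¹ * a * g') * V'.prod ∈ A := by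
        simpa only [List.prod_cons, mul_inv_rev, mul_assoc] using h
      -- If this product lies in A, it takes the role of a for the remaining words. Otherwise the
      -- two letters fuse into one letter and W⁻¹aW' is again an alternating product.
      by_cases hg : g⁻¹ * a * g' ∈ A
      · obtain ⟨h1, -, h3⟩ := ih hW.2.2 hW'.2.2 hg hprod
        refine ⟨by simp [h1], fun _ => rfl, fun k => ?_⟩
        cases k with
        | zero => simpa using ha
        | succ k =>
          simpa only [List.take_succ_cons, List.prod_cons, mul_inv_rev, mul_assoc] using h3 k
      · have hV' : IsAlternating A S (!!b) (g⁻¹ * a * g' :: V') :=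
          ⟨by simpa [mul_assoc] using (S b).mul_mem ((S b).inv_mem hW.1) hW''.1, hg,
            by simpa using hW'.2.2⟩
        refine absurd ?_ (hA.inv_mul_mul_notMem hW.2.2 hV' (by simp))
        simpa only [List.prod_cons, mul_assoc] using hprod

end Alternating

/-! ## Prefixes of elements -/

section Prefixes

variable {Γ : Type*} [Group Γ] {A : Subgroup Γ} {S : Bool → Subgroup Γ}

/-- `w` has a normal form that begins with a letter of type `b` and whose first `k` letters
represent the coset `τ A`. -/
def IsPrefixFrom (A : Subgroup Γ) (S : Bool → Subgroup Γ) (b : Bool) (k : ℕ) (w τ : Γ) : Prop :=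
  ∃ V₁ V₂ : List Γ, ∃ a ∈ A, IsAlternating A S b (V₁ ++ V₂) ∧ V₁.length = k ∧
    w = V₁.prod * V₂.prod * a ∧ V₁.prod⁻¹ * τ ∈ A

/-- The first `k` letters in a normal form of `w` represent the coset `τ A`. -/
def IsPrefixCoset (A : Subgroup Γ) (S : Bool → Subgroup Γ) (k : ℕ) (w τ : Γ) : Prop :=
  ∃ b, IsPrefixFrom A S b k w τ

theorem IsAmalgamPair.prefix_unique (hA : IsAmalgamPair A S) {k : ℕ} {w τ τ' : Γ}
    (h : IsPrefixCoset A S k w τ) (h' : IsPrefixCoset A S k w τ') : τ⁻¹ * τ' ∈ A := by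
  obtain ⟨b, V₁, V₂, a, ha, hV, rfl, hw, hτ⟩ := h
  obtain ⟨b', V₁', V₂', a', ha', hV', hk, hw', hτ'⟩ := h'
  have h1 : (V₁ ++ V₂).prod⁻¹ * 1 * (V₁' ++ V₂').prod ∈ A := by
    have : (V₁ ++ V₂).prod⁻¹ * 1 * (V₁' ++ V₂').prod = a * a'⁻¹ := by
      rw [List.prod_append, List.prod_append, eq_mul_inv_of_mul_eq hw.symm,
        eq_mul_inv_of_mul_eq hw'.symm]
      group
    rw [this]; exact A.mul_mem ha (A.inv_mem ha')
  have h2 := (hA.eq_shape hV hV' A.one_mem h1).2.2 V₁.length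
  rw [List.take_left, ← hk, List.take_left, mul_one] at h2
  have : τ⁻¹ * τ' = (V₁.prod⁻¹ * τ)⁻¹ * (V₁.prod⁻¹ * V₁'.prod) * (V₁'.prod⁻¹ * τ') := by group
  rw [this]
  exact A.mul_mem (A.mul_mem (A.inv_mem hτ) h2) hτ'

theorem isPrefixFrom_zero {b : Bool} {Z : List Γ} {a : Γ} (hZ : IsAlternating A S b Z)
    (ha : a ∈ A) : IsPrefixFrom A S b 0 (Z.prod * a) 1 :=
  ⟨[], Z, a, ha, hZ, rfl, by simp, by simp⟩

theorem IsAlternating.isPrefixCoset_inv {b : Bool} {W V : List Γ} {a : Γ}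
    (hW : IsAlternating A S b W) (hV : IsAlternating A S (!b) V) (ha : a ∈ A) :
    IsPrefixCoset A S W.length (W.prod⁻¹ * (V.prod * a)) W.prod⁻¹ := by
  obtain ⟨b', U, h1, h2, h3, -⟩ := hW.exists_inv_append (fun _ _ => 0) (fun _ _ _ => rfl) hV
  exact ⟨b', U, V, a, ha, h1, h2, by rw [h3, mul_assoc], by rw [h3]; simp⟩

/-- The normal forms of `u` and `z` diverge either after a common prefix of `u` and `z`, the rest
of `u` being an inverse prefix of `u⁻¹ z`, or at a single letter in between. -/
theorem IsAmalgamPair.exists_divergence_of_same_type (hA : IsAmalgamPair A S) {b : Bool}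
    {W Z : List Γ} {a : Γ} (hW : IsAlternating A S b W) (hZ : IsAlternating A S b Z) (ha : a ∈ A) :
    (∃ W₁ W₂, W = W₁ ++ W₂ ∧ IsPrefixFrom A S b W₁.length (Z.prod * a) W₁.prod ∧
      IsPrefixCoset A S W₂.length (W.prod⁻¹ * (Z.prod * a)) W₂.prod⁻¹) ∨
    (∃ W₁ g W₂, W = W₁ ++ g :: W₂ ∧ IsPrefixFrom A S b W₁.length (Z.prod * a) W₁.prod ∧
      IsPrefixCoset A S W₂.length (W.prod⁻¹ * (Z.prod * a)) W₂.prod⁻¹) := by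
  induction W generalizing b Z a with
  | nil =>
    refine Or.inl ⟨[], [], rfl, isPrefixFrom_zero hZ ha, b, ?_⟩
    simpa using isPrefixFrom_zero hZ ha
  | cons g W ih =>
    cases Z with
    | nil =>
      exact Or.inl ⟨[], g :: W, rfl, isPrefixFrom_zero hZ ha,
        hW.isPrefixCoset_inv (V := []) trivial ha⟩
    | cons g' Z =>
      by_cases hg : g⁻¹ * g' ∈ A
      -- The first letters agree modulo A. Their discrepancy g⁻¹g' is absorbed into the next letter
      -- of Z, or into the final factor a if there is none.
      · have key : ∃ Z' a', a' ∈ A ∧ IsAlternating A S (!b) Z' ∧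
            Z'.prod * a' = g⁻¹ * ((g' :: Z).prod * a) := by
          cases Z with
          | nil => exact ⟨[], g⁻¹ * g' * a, A.mul_mem hg ha, trivial, by simp [mul_assoc]⟩
          | cons g'' Z =>
            exact ⟨(g⁻¹ * g') * g'' :: Z, a, ha, hA.smul_alternating hZ.2.2 hg,
              by simp [mul_assoc]⟩
        obtain ⟨Z', a', ha', hZ', hprod⟩ := key
        have hlift : ∀ V₁ : List Γ, IsPrefixFrom A S (!b) V₁.length (Z'.prod * a') V₁.prod →
            IsPrefixFrom A S b (g :: V₁).length ((g' :: Z).prod * a) (g :: V₁).prod := by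
          rintro V ⟨V₁, V₂, c, hc, hV, hlen, hw, hτ⟩
          refine ⟨g :: V₁, V₂, c, hc, ⟨hW.1, hW.2.1, hV⟩, by simp [hlen], ?_, ?_⟩
          · rw [hprod] at hw
            rw [eq_mul_of_inv_mul_eq hw]
            simp [mul_assoc]
          · simpa [mul_assoc] using hτ
        have hy : (g :: W).prod⁻¹ * ((g' :: Z).prod * a) = W.prod⁻¹ * (Z'.prod * a') := by
          rw [hprod, List.prod_cons, mul_inv_rev, mul_assoc]
        rw [hy]
        rcases ih hW.2.2 hZ' ha' with ⟨W₁, W₂, rfl, h1, h2⟩ | ⟨W₁, h, W₂, rfl, h1, h2⟩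
        · exact Or.inl ⟨g :: W₁, W₂, rfl, hlift W₁ h1, h2⟩
        · exact Or.inr ⟨g :: W₁, h, W₂, rfl, hlift W₁ h1, h2⟩
      · refine Or.inr ⟨[], g, W, rfl, isPrefixFrom_zero hZ ha, ?_⟩
        have hV : IsAlternating A S (!!b) (g⁻¹ * g' :: Z) :=
          ⟨by simpa using (S b).mul_mem ((S b).inv_mem hW.1) hZ.1, hg, by simpa using hZ.2.2⟩
        have := hW.2.2.isPrefixCoset_inv hV ha
        simpa only [List.prod_cons, mul_inv_rev, mul_assoc] using this

theorem IsAmalgamPair.exists_divergence (hA : IsAmalgamPair A S)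
    (hrep : ∀ z, ∃ b Z, IsAlternating A S b Z ∧ ∃ a ∈ A, z = Z.prod * a) {b : Bool}
    {W : List Γ} (hW : IsAlternating A S b W) (z : Γ) :
    (∃ W₁ W₂, W = W₁ ++ W₂ ∧ IsPrefixCoset A S W₁.length z W₁.prod ∧
      IsPrefixCoset A S W₂.length (W.prod⁻¹ * z) W₂.prod⁻¹) ∨
    (∃ W₁ g W₂, W = W₁ ++ g :: W₂ ∧ IsPrefixCoset A S W₁.length z W₁.prod ∧
      IsPrefixCoset A S W₂.length (W.prod⁻¹ * z) W₂.prod⁻¹) := by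
  obtain ⟨b', Z, hZ, a, ha, rfl⟩ := hrep z
  by_cases hb : b' = !b
  · subst hb
    -- Different initial types: nothing cancels in u⁻¹z, so the common prefix is empty and all of W
    -- is an inverse prefix of u⁻¹z.
    exact Or.inl ⟨[], W, rfl, ⟨_, isPrefixFrom_zero hZ ha⟩, hW.isPrefixCoset_inv hZ ha⟩
  have hb' : b' = b := by revert hb; cases b <;> cases b' <;> simp
  subst hb'
  rcases hA.exists_divergence_of_same_type hW hZ ha with
    ⟨W₁, W₂, h, h1, h2⟩ | ⟨W₁, g, W₂, h, h1, h2⟩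
  · exact Or.inl ⟨W₁, W₂, h, ⟨_, h1⟩, h2⟩
  · exact Or.inr ⟨W₁, g, W₂, h, ⟨_, h1⟩, h2⟩

/-- Representatives of prefix cosets, given by alternating words of minimal length. -/
theorem IsAmalgamPair.exists_marker (hA : IsAmalgamPair A S)
    (hrep : ∀ z, ∃ b Z, IsAlternating A S b Z ∧ ∃ a ∈ A, z = Z.prod * a) (l : Bool → Γ → ℕ) :
    ∃ E : ℕ → Γ → Γ,
      (∀ k w τ, IsPrefixCoset A S k w τ → ∃ b V, IsAlternating A S b V ∧ V.prod = E k w ∧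
        τ⁻¹ * E k w ∈ A ∧ ∀ b' W, IsAlternating A S b' W → W.prod⁻¹ * τ ∈ A →
          altLength l b V ≤ altLength l b' W) ∧
      ∀ k w w' τ, IsPrefixCoset A S k w τ → IsPrefixCoset A S k w' τ → E k w = E k w' := by
  classical
  have hmin : ∀ q : Γ ⧸ A, ∃ m : Γ, (m : Γ ⧸ A) = q ∧ ∃ b V, IsAlternating A S b V ∧
      V.prod = m ∧ ∀ b' W, IsAlternating A S b' W → (W.prod : Γ ⧸ A) = q →
        altLength l b V ≤ altLength l b' W := by
    intro q
    have hex : ∃ n b V, IsAlternating A S b V ∧ (V.prod : Γ ⧸ A) = q ∧ altLength l b V = n := by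
      obtain ⟨z, rfl⟩ := QuotientGroup.mk_surjective q
      obtain ⟨b, Z, hZ, a, ha, rfl⟩ := hrep z
      exact ⟨_, b, Z, hZ, QuotientGroup.eq.2 (by simpa using ha), rfl⟩
    obtain ⟨b, V, h1, h2, h3⟩ := Nat.find_spec hex
    refine ⟨V.prod, h2, b, V, h1, rfl, fun b' W hW hq => ?_⟩
    rw [h3]
    exact Nat.find_min' hex ⟨b', W, hW, hq, rfl⟩
  choose m hm hm' using hmin
  -- The value 1 is a default for k exceeding the number of letters in the normal form of w.
  let E : ℕ → Γ → Γ := fun k w => if h : ∃ τ, IsPrefixCoset A S k w τ then m h.choose else 1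
  have hE : ∀ k w τ, IsPrefixCoset A S k w τ → E k w = m τ := by
    intro k w τ h
    have h' : ∃ τ, IsPrefixCoset A S k w τ := ⟨τ, h⟩
    simp only [E, dif_pos h']
    congr 1
    exact QuotientGroup.eq.2 (hA.prefix_unique h'.choose_spec h)
  refine ⟨E, fun k w τ h => ?_, fun k w w' τ h h' => by rw [hE k w τ h, hE k w' τ h']⟩
  obtain ⟨b, V, h1, h2, h3⟩ := hm' τ
  rw [hE k w τ h]
  exact ⟨b, V, h1, h2, QuotientGroup.eq.1 (hm τ).symm,
    fun b' W hW hWτ => h3 b' W hW (QuotientGroup.eq.2 hWτ)⟩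

end Prefixes

/-! ## Lengths of alternating words -/

section Lengths

variable {Γ : Type*} [Group Γ]

/-- Length functions on the two subgroups `S b`, for which the elements of length zero lie in `A`
and have length zero in both subgroups. -/
structure IsLengthPair (A : Subgroup Γ) (S : Bool → Subgroup Γ) (l : Bool → Γ → ℕ) : Prop where
  one : ∀ b, l b 1 = 0
  inv : ∀ b, ∀ g ∈ S b, l b g⁻¹ = l b g
  mul_le : ∀ b, ∀ g ∈ S b, ∀ h ∈ S b, l b (g * h) ≤ l b g + l b h
  zero : ∀ b, ∀ g ∈ S b, l b g = 0 → g ∈ A ∧ l (!b) g = 0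

/-- Passing from one length to the other increases the lengths of elements of `A` at most by
a factor `1 + c`, or by `c * n` where the length is less than `n`. -/
def ConversionBound (A : Subgroup Γ) (l : Bool → Γ → ℕ) (n : ℕ) (c : ℝ) : Prop :=
  ∀ b, ∀ a ∈ A, (l (!b) a : ℝ) ≤ l b a + c * max (l b a : ℝ) n

/-- The excess length allowed after `t` conversions, in words of total length at most `D`. -/
noncomputable def conversionExcess (D c : ℝ) (t : ℕ) : ℝ := D * ((1 + c) ^ t - 1)

section Excess

variable {D c : ℝ}

theorem conversionExcess_succ (t : ℕ) :
    conversionExcess D c (t + 1) = conversionExcess D c t + c * (D * (1 + c) ^ t) := by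
  unfold conversionExcess; ring

theorem conversionExcess_mono (hD : 0 ≤ D) (hc : 0 ≤ c) {t t' : ℕ} (h : t ≤ t') :
    conversionExcess D c t ≤ conversionExcess D c t' := by
  unfold conversionExcess
  have : (1 + c) ^ t ≤ (1 + c) ^ t' := pow_le_pow_right₀ (by linarith) h
  gcongr

theorem conversionExcess_add (hD : 0 ≤ D) (hc : 0 ≤ c) (t t' : ℕ) :
    conversionExcess D c t + conversionExcess D c t' ≤ conversionExcess D c (t + t') := by
  have h1 : 0 ≤ (1 + c) ^ t - 1 := sub_nonneg.2 (one_le_pow₀ (by linarith))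
  have h2 : 0 ≤ (1 + c) ^ t' - 1 := sub_nonneg.2 (one_le_pow₀ (by linarith))
  unfold conversionExcess
  rw [pow_add]
  nlinarith [mul_nonneg hD (mul_nonneg h1 h2)]

theorem conversionExcess_add_mul (hD : 0 ≤ D) (hc : 0 ≤ c) (t : ℕ) :
    conversionExcess D c t + c * D ≤ conversionExcess D c (t + 1) := by
  rw [conversionExcess_succ]
  have : D ≤ D * (1 + c) ^ t := le_mul_of_one_le_right hD (one_le_pow₀ (by linarith))
  gcongr

/-- After t conversions everything is bounded by D(1 + c)^t, so one more adds at most c · D(1 +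
c)^t, which is the increment of `conversionExcess`. -/
theorem add_mul_max_le_conversionExcess (hD : 0 ≤ D) (hc : 0 ≤ c) {x s : ℝ} {n t : ℕ}
    (hx : x ≤ s + conversionExcess D c t) (hs : s ≤ D) (hn : (n : ℝ) ≤ D) :
    x + c * max x n ≤ s + conversionExcess D c (t + 1) := by
  have h1 : x ≤ D * (1 + c) ^ t := by unfold conversionExcess at hx; linarith
  have h2 : (n : ℝ) ≤ D * (1 + c) ^ t :=
    hn.trans (le_mul_of_one_le_right hD (one_le_pow₀ (by linarith)))
  rw [conversionExcess_succ]
  have := mul_le_mul_of_nonneg_left (max_le h1 h2) hc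
  linarith

end Excess

variable {A : Subgroup Γ} {S : Bool → Subgroup Γ} {l : Bool → Γ → ℕ} {n : ℕ} {c : ℝ}

theorem ConversionBound.convert (h : ConversionBound A l n c) (hc : 0 ≤ c) {D : ℝ}
    (hn : (n : ℝ) ≤ D) {b : Bool} {a : Γ} (ha : a ∈ A) {s : ℝ} {t : ℕ} (hs : s ≤ D)
    (hx : (l b a : ℝ) ≤ s + conversionExcess D c t) (b' : Bool) :
    (l b' a : ℝ) ≤ s + conversionExcess D c (t + 1) := by
  have hD : 0 ≤ D := n.cast_nonneg.trans hn
  have h1 := add_mul_max_le_conversionExcess hD hc hx hs hn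
  by_cases hb : b' = !b
  · subst hb; exact (h b a ha).trans h1
  · have : b' = b := by revert hb; cases b <;> cases b' <;> simp
    subst this
    exact hx.trans (by gcongr; exact conversionExcess_mono hD hc (Nat.le_succ t))

/-- Two alternating words of the same shape that represent the same coset differ by a short
element of `A`. -/
theorem IsLengthPair.length_inv_mul_le (hl : IsLengthPair A S l) (hA : IsAmalgamPair A S)
    (hcv : ConversionBound A l n c) (hc : 0 ≤ c) {D : ℝ} (hn : (n : ℝ) ≤ D) {b : Bool}
    {W W' : List Γ} {a : Γ} {s : ℝ} {t : ℕ} (hW : IsAlternating A S b W)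
    (hW' : IsAlternating A S b W') (ha : a ∈ A) (h : W.prod⁻¹ * a * W'.prod ∈ A)
    (hs : s + altLength l b W + altLength l b W' ≤ D)
    (hat : ∀ b', (l b' a : ℝ) ≤ s + conversionExcess D c t) (b' : Bool) :
    (l b' (W.prod⁻¹ * a * W'.prod) : ℝ) ≤
      s + altLength l b W + altLength l b W' + conversionExcess D c (t + W.length) := by
  induction W generalizing b W' a s t with
  | nil =>
    have := (hA.eq_shape hW hW' ha h).1
    rw [List.length_nil, eq_comm, List.length_eq_zero_iff] at this
    subst this
    simpa [altLength] using hat b'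
  | cons g V ih =>
    have hsh := hA.eq_shape hW hW' ha h
    cases W' with
    | nil => simp at hsh
    | cons g' V' =>
      have hg : g⁻¹ * a * g' ∈ A := by simpa using hsh.2.2 1
      have hprod : (g :: V).prod⁻¹ * a * (g' :: V').prod = V.prod⁻¹ * (g⁻¹ * a * g') * V'.prod := by
        simp only [List.prod_cons, mul_inv_rev, mul_assoc]
      rw [hprod] at h ⊢
      have hab := hA.le b ha
      have h1 : l b (g⁻¹ * a * g') ≤ l b g + l b a + l b g' := by
        refine (hl.mul_le b _ ((S b).mul_mem ((S b).inv_mem hW.1) hab) _ hW'.1).trans ?_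
        refine Nat.add_le_add_right ((hl.mul_le b _ ((S b).inv_mem hW.1) _ hab).trans ?_) _
        rw [hl.inv b g hW.1]
      have h1' : (l b (g⁻¹ * a * g') : ℝ) ≤ l b g + l b a + l b g' := by exact_mod_cast h1
      simp only [altLength, Nat.cast_add] at hs ⊢
      have hV0 : (0 : ℝ) ≤ altLength l (!b) V := Nat.cast_nonneg _
      have hV0' : (0 : ℝ) ≤ altLength l (!b) V' := Nat.cast_nonneg _
      -- All three factors lie in `S b`, where the triangle inequality applies; passing on to the
      -- next letters, of the other type, takes one conversion.
      have h2 := fun b'' => hcv.convert hc hn hg (b := b) (s := s + l b g + l b g') (t := t)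
        (by linarith) (by linarith [hat b]) b''
      have h3 := ih hW.2.2 hW'.2.2 hg h (by linarith) h2
      have ht : t + (g :: V).length = t + 1 + V.length := by
        simp only [List.length_cons]; omega
      rw [ht]
      linarith

/-- Either `u` is a short element of `A`, or it is represented by a short alternating word;
`s` bounds the length of a word representing `u`. -/
def HasShortForm (A : Subgroup Γ) (S : Bool → Subgroup Γ) (l : Bool → Γ → ℕ) (n : ℕ) (c : ℝ)
    (s : ℕ) (u : Γ) : Prop :=
  (u ∈ A ∧ ∀ b, (l b u : ℝ) ≤ s + conversionExcess n c s) ∨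
    ∃ b W, IsAlternating A S b W ∧ W ≠ [] ∧ W.length ≤ s ∧ W.prod = u ∧
      (altLength l b W : ℝ) ≤ s + conversionExcess n c (s - W.length)

/-- A letter of length zero has no unit of length to pay for a conversion; none is needed because it
lies in A and vanishes in both lengths. -/
theorem HasShortForm.mul_zero (hl : IsLengthPair A S l) (hA : IsAmalgamPair A S) {s : ℕ} {u g : Γ}
    (hu : HasShortForm A S l n c s u) (hg : g ∈ A) (hg0 : ∀ b, l b g = 0) :
    HasShortForm A S l n c s (g * u) := by
  rcases hu with ⟨hu, h⟩ | ⟨b, W, hW, hne, hlen, rfl, h⟩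
  · refine Or.inl ⟨A.mul_mem hg hu, fun b => le_trans ?_ (h b)⟩
    have := hl.mul_le b g (hA.le b hg) u (hA.le b hu)
    rw [hg0, zero_add] at this
    exact_mod_cast this
  · cases W with
    | nil => exact absurd rfl hne
    | cons k V =>
      refine Or.inr ⟨b, g * k :: V, hA.smul_alternating hW hg, by simp, hlen, by simp [mul_assoc],
        le_trans ?_ h⟩
      have := hl.mul_le b g (hA.le b hg) k hW.1
      rw [hg0, zero_add] at this
      exact_mod_cast Nat.add_le_add_right this _

/-- Absorbing g into the first letter may require measuring g in the other length. This one
conversion is paid for by r ≥ 1, and the number of letters is unchanged. -/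
theorem HasShortForm.mul_amalgam (hl : IsLengthPair A S l) (hA : IsAmalgamPair A S)
    (hcv : ConversionBound A l n c) (hc : 0 ≤ c) {s r : ℕ} {u g : Γ}
    (hu : HasShortForm A S l n c s u) (hg : g ∈ A) {b : Bool} (hgr : l b g = r) (hr : 1 ≤ r)
    (hs : r + s ≤ n) : HasShortForm A S l n c (r + s) (g * u) := by
  have hn0 : (0 : ℝ) ≤ n := n.cast_nonneg
  have hg' : ∀ b', (l b' g : ℝ) ≤ r + c * n := by
    intro b'
    have := hcv.convert hc le_rfl hg (b := b) (s := r) (t := 0) (by exact_mod_cast (by omega))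
      (by simp [conversionExcess, hgr]) b'
    simpa [conversionExcess, mul_comm] using this
  have hexc : ∀ t t', t + 1 ≤ t' → conversionExcess n c t + c * n ≤ conversionExcess n c t' :=
    fun t t' h => (conversionExcess_add_mul hn0 hc t).trans (conversionExcess_mono hn0 hc h)
  rcases hu with ⟨hu, h⟩ | ⟨b, W, hW, hne, hlen, rfl, h⟩
  · refine Or.inl ⟨A.mul_mem hg hu, fun b' => ?_⟩
    have h1 : (l b' (g * u) : ℝ) ≤ l b' g + l b' u := by
      exact_mod_cast hl.mul_le b' g (hA.le b' hg) u (hA.le b' hu)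
    have := hexc s (r + s) (by omega)
    push_cast
    linarith [h b', hg' b']
  · cases W with
    | nil => exact absurd rfl hne
    | cons k V =>
      refine Or.inr ⟨b, g * k :: V, hA.smul_alternating hW hg, by simp,
        by simp only [List.length_cons] at hlen ⊢; omega, by simp [mul_assoc], ?_⟩
      have h1 : (l b (g * k) : ℝ) ≤ l b g + l b k := by
        exact_mod_cast hl.mul_le b g (hA.le b hg) k hW.1
      have := hexc (s - (k :: V).length) (r + s - (g * k :: V).length)
        (by simp only [List.length_cons] at hlen ⊢; omega)
      simp only [altLength, Nat.cast_add] at h ⊢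
      linarith [hg' b]

/-- The letter g is prepended, or fuses with a first letter of the same type. A new letter is paid
for by r ≥ 1. If the fused letter falls into A, it is converted and pushed into the following
letter. -/
theorem HasShortForm.mul_letter (hl : IsLengthPair A S l) (hA : IsAmalgamPair A S)
    (hcv : ConversionBound A l n c) (hc : 0 ≤ c) {s r : ℕ} {u g : Γ}
    (hu : HasShortForm A S l n c s u) {b : Bool} (hgS : g ∈ S b) (hgA : g ∉ A) (hgr : l b g = r)
    (hr : 1 ≤ r) (hs : r + s ≤ n) : HasShortForm A S l n c (r + s) (g * u) := by
  have hn0 : (0 : ℝ) ≤ n := n.cast_nonneg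
  have hsn : (r : ℝ) + s ≤ n := by exact_mod_cast hs
  have hgr' : (l b g : ℝ) = r := by rw [hgr]
  have hmul : ∀ k ∈ S b, (l b (g * k) : ℝ) ≤ r + l b k := fun k hk => by
    rw [← hgr']; exact_mod_cast hl.mul_le b g hgS k hk
  have hexc := fun {t t'} => conversionExcess_mono (D := n) (t := t) (t' := t') hn0 hc
  rcases hu with ⟨hu, h⟩ | ⟨b', W, hW, hne, hlen, rfl, h⟩
  · refine Or.inr ⟨b, [g * u], ⟨(S b).mul_mem hgS (hA.le b hu),
      fun h' => hgA ((A.mul_mem_cancel_right hu).1 h'), trivial⟩, by simp, by simp; omega,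
      by simp, ?_⟩
    have := hexc (show s ≤ r + s - [g * u].length by simp only [List.length_singleton]; omega)
    simp only [altLength, Nat.cast_add, add_zero]
    linarith [h b, hmul u (hA.le b hu)]
  by_cases hb : b = !b'
  · subst hb
    refine Or.inr ⟨!b', g :: W, ⟨hgS, hgA, by simpa using hW⟩, by simp,
      by simp only [List.length_cons]; omega, by simp, ?_⟩
    have := hexc (show s - W.length ≤ r + s - (g :: W).length by
      simp only [List.length_cons]; omega)
    simp only [altLength, Nat.cast_add, Bool.not_not]
    linarith
  have hb' : b' = b := by revert hb; cases b <;> cases b' <;> simp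
  subst hb'
  cases W with
  | nil => exact absurd rfl hne
  | cons k V =>
    have hk := hmul k hW.1
    simp only [altLength, Nat.cast_add, List.length_cons] at h hlen
    by_cases hgk : g * k ∈ A
    · have hV0 : (0 : ℝ) ≤ altLength l (!b') V := Nat.cast_nonneg _
      -- The one case with a conversion: gk is measured in the other length, at the price of one
      -- unit of excess. The word loses a letter, and the budget `s - W.length` rises accordingly.
      have hconv := hcv.convert hc le_rfl hgk (b := b') (s := r + s - altLength l (!b') V)
        (t := s - (V.length + 1)) (by linarith) (by linarith)
      cases V with
      | nil =>
        refine Or.inl ⟨by simpa using hgk, fun b'' => ?_⟩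
        have := hexc (show s - (([] : List Γ).length + 1) + 1 ≤ r + s by
          simp only [List.length_nil]; omega)
        have h2 := hconv b''
        simp only [altLength, List.prod_cons, List.prod_nil, mul_one, Nat.cast_add] at h2 ⊢
        push_cast at h2
        linarith
      | cons k' V =>
        have hV := hA.smul_alternating hW.2.2 hgk
        simp only [List.length_cons] at hlen hconv h
        refine Or.inr ⟨!b', g * k * k' :: V, hV, by simp,
          by simp only [List.length_cons]; omega, by simp [mul_assoc], ?_⟩
        have := hexc (show s - (V.length + 1 + 1) + 1 ≤ r + s - (g * k * k' :: V).length by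
          simp only [List.length_cons]; omega)
        have h1 : (l (!b') (g * k * k') : ℝ) ≤ l (!b') (g * k) + l (!b') k' := by
          exact_mod_cast hl.mul_le _ _ (hA.le _ hgk) _ hW.2.2.1
        have h2 := hconv (!b')
        simp only [altLength, Nat.cast_add] at h2 ⊢
        linarith
    · refine Or.inr ⟨b', g * k :: V, ⟨(S b').mul_mem hgS hW.1, hgk, hW.2.2⟩, by simp,
        by simp only [List.length_cons]; omega, by simp [mul_assoc], ?_⟩
      have := hexc (show s - (V.length + 1) ≤ r + s - (g * k :: V).length by
        simp only [List.length_cons]; omega)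
      simp only [altLength, Nat.cast_add]
      linarith

theorem IsLengthPair.hasShortForm (hl : IsLengthPair A S l) (hA : IsAmalgamPair A S)
    (hcv : ConversionBound A l n c) (hc : 0 ≤ c) (w : List (Bool × Γ))
    (hw : ∀ p ∈ w, p.2 ∈ S p.1) (hn : (w.map fun p => l p.1 p.2).sum ≤ n) :
    HasShortForm A S l n c (w.map fun p => l p.1 p.2).sum (w.map Prod.snd).prod := by
  induction w with
  | nil =>
    refine Or.inl ⟨by simp, fun b => ?_⟩
    simp [hl.one, conversionExcess]
  | cons p w ih =>
    obtain ⟨b, g⟩ := p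
    simp only [List.map_cons, List.sum_cons, List.prod_cons] at hn ⊢
    have ih' := ih (fun p hp => hw p (List.mem_cons_of_mem _ hp)) (by omega)
    have hg : g ∈ S b := hw (b, g) (List.mem_cons_self ..)
    rcases Nat.eq_zero_or_pos (l b g) with h0 | hpos
    · obtain ⟨h1, h2⟩ := hl.zero b g hg h0
      rw [h0, zero_add]
      exact ih'.mul_zero hl hA h1 fun b' => by
        by_cases hb : b' = !b
        · rw [hb, h2]
        · have : b' = b := by revert hb; cases b <;> cases b' <;> simp
          rw [this, h0]
    · by_cases hgA : g ∈ A
      · exact ih'.mul_amalgam hl hA hcv hc hgA rfl hpos hn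
      · exact ih'.mul_letter hl hA hcv hc hg hgA rfl hpos hn

end Lengths

/-! ## Decay for amalgams -/

section AmalgamDecay

variable {Γ : Type*} [Group Γ] {A : Subgroup Γ} {S : Bool → Subgroup Γ} {l : Bool → Γ → ℕ}
  {n : ℕ} {c : ℝ}

/-- The inverse word, with a record of which of its letters come from W₂; V serves the induction. -/
theorem IsAlternating.exists_inv_append_append {W₁ W₂ V : List Γ} {b : Bool}
    (hW : IsAlternating A S b (W₁ ++ W₂)) (hV : IsAlternating A S (!b) V) :
    ∃ b' U₁ U₂, IsAlternating A S b' (U₁ ++ (U₂ ++ V)) ∧ U₁.length = W₂.length ∧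
      U₁.prod = W₂.prod⁻¹ ∧ U₂.prod = W₁.prod⁻¹ := by
  induction W₁ generalizing b V with
  | nil =>
    obtain ⟨b', U, h1, h2, h3, -⟩ := hW.exists_inv_append (fun _ _ => 0) (fun _ _ _ => rfl) hV
    exact ⟨b', U, [], h1, h2, h3, by simp⟩
  | cons g W ih =>
    obtain ⟨h1, h2, h3⟩ := hW
    obtain ⟨b', U₁, U₂, h4, h5, h6, h7⟩ := ih (V := g⁻¹ :: V) h3
      ⟨by simpa using h1, by simpa using h2, by simpa using hV⟩
    exact ⟨b', U₁, U₂ ++ [g⁻¹], by simpa using h4, h5, h6, by simp [h7]⟩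

theorem IsAlternating.isPrefixCoset_left {W₁ W₂ : List Γ} {b : Bool}
    (hW : IsAlternating A S b (W₁ ++ W₂)) :
    IsPrefixCoset A S W₁.length (W₁ ++ W₂).prod W₁.prod :=
  ⟨b, W₁, W₂, 1, A.one_mem, hW, rfl, by simp, by simp⟩

theorem IsAlternating.isPrefixCoset_right {W₁ W₂ : List Γ} {b : Bool}
    (hW : IsAlternating A S b (W₁ ++ W₂)) :
    IsPrefixCoset A S W₂.length (W₁ ++ W₂).prod⁻¹ W₂.prod⁻¹ := by
  obtain ⟨b', U₁, U₂, h1, h2, h3, h4⟩ := hW.exists_inv_append_append (V := []) trivial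
  rw [List.append_nil] at h1
  exact ⟨b', U₁, U₂, 1, A.one_mem, h1, h2, by simp [h3, h4], by simp [h3]⟩

/-- The element `m` represents the coset `τ A` by an alternating word of minimal length. -/
def IsMinimalIn (A : Subgroup Γ) (S : Bool → Subgroup Γ) (l : Bool → Γ → ℕ) (τ m : Γ) : Prop :=
  ∃ b V, IsAlternating A S b V ∧ V.prod = m ∧ τ⁻¹ * m ∈ A ∧
    ∀ b' W, IsAlternating A S b' W → W.prod⁻¹ * τ ∈ A → altLength l b V ≤ altLength l b' W

/-- By minimality the word for m is no longer than W, and it has the same shape since it represents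
the same coset. Comparing the two words costs twice the length of W and one conversion per letter.
-/
theorem IsLengthPair.length_minimal_le (hl : IsLengthPair A S l) (hA : IsAmalgamPair A S)
    (hcv : ConversionBound A l n c) (hc : 0 ≤ c) {D : ℝ} (hn : (n : ℝ) ≤ D) {b : Bool}
    {W : List Γ} {m : Γ} (hW : IsAlternating A S b W) (hm : IsMinimalIn A S l W.prod m)
    (hD : 2 * (altLength l b W : ℝ) ≤ D) :
    W.prod⁻¹ * m ∈ A ∧ ∀ b', (l b' (W.prod⁻¹ * m) : ℝ) ≤
      2 * altLength l b W + conversionExcess D c W.length := by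
  have hD0 : 0 ≤ D := n.cast_nonneg.trans hn
  obtain ⟨b₁, V, hV, rfl, hτ, hmin⟩ := hm
  have h1 : (altLength l b₁ V : ℝ) ≤ altLength l b W := by
    exact_mod_cast hmin b W hW (by simp)
  refine ⟨hτ, fun b' => ?_⟩
  have hτ' : W.prod⁻¹ * 1 * V.prod ∈ A := by simpa using hτ
  by_cases hne : W = []
  · subst hne
    have := (hA.eq_shape hW hV A.one_mem hτ').1
    rw [List.length_nil, eq_comm, List.length_eq_zero_iff] at this
    subst this
    simp [hl.one, altLength, conversionExcess]
  have hb := (hA.eq_shape hW hV A.one_mem hτ').2.1 hne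
  subst hb
  have h2 := hl.length_inv_mul_le hA hcv hc hn (s := 0) (t := 0) hW hV A.one_mem hτ'
    (by linarith) (fun b'' => by simp [hl.one, conversionExcess]) b'
  rw [mul_one] at h2
  simp only [zero_add] at h2
  linarith

/-- The normal form W of u has used at most n - |W| conversions. Trimming both ends to their markers
uses at most |W| more, so n conversions bound the whole process. -/
theorem HasShortForm.exists_markers (hl : IsLengthPair A S l) (hA : IsAmalgamPair A S)
    (hcv : ConversionBound A l n c) (hc : 0 ≤ c)
    (hrep : ∀ z, ∃ b Z, IsAlternating A S b Z ∧ ∃ a ∈ A, z = Z.prod * a)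
    {E : ℕ → Γ → Γ} (hE : ∀ k w τ, IsPrefixCoset A S k w τ → IsMinimalIn A S l τ (E k w))
    (hE' : ∀ k w w' τ, IsPrefixCoset A S k w τ → IsPrefixCoset A S k w' τ → E k w = E k w')
    {s : ℕ} (hs : s ≤ n) {u : Γ} (hu : HasShortForm A S l n c s u) (z : Γ) :
    ∃ b k k', k ≤ n ∧ k' ≤ n ∧ (b = true → k < n ∧ k' < n) ∧ E k u = E k z ∧
      E k' u⁻¹ = E k' (u⁻¹ * z) ∧ (E k u)⁻¹ * u * E k' u⁻¹ ∈ S b ∧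
      (l b ((E k u)⁻¹ * u * E k' u⁻¹) : ℝ) ≤ 2 * n * (1 + c) ^ n := by
  have hn0 : (0 : ℝ) ≤ n := n.cast_nonneg
  have hsn : (s : ℝ) ≤ n := by exact_mod_cast hs
  have hpow : ∀ t, (1 : ℝ) ≤ (1 + c) ^ t := fun t => one_le_pow₀ (by linarith)
  rcases hu with ⟨huA, h⟩ | ⟨b, W, hW, hne, hlen, rfl, h⟩
  · have h0 : ∀ w, IsPrefixCoset A S 0 w 1 := fun w => by
      obtain ⟨b, Z, hZ, a, ha, rfl⟩ := hrep w
      exact ⟨b, isPrefixFrom_zero hZ ha⟩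
    -- The marker of an empty prefix lies in A, so its alternating word must be empty.
    have hE1 : ∀ w, E 0 w = 1 := fun w => by
      obtain ⟨b, V, hV, hV1, hV2, -⟩ := hE 0 w 1 (h0 w)
      have hV3 : E 0 w ∈ A := by simpa using hV2
      by_cases hne : V = []
      · rw [← hV1, hne, List.prod_nil]
      · exact absurd (hV1 ▸ hV3) (hA.prod_notMem b V hV hne)
    refine ⟨false, 0, 0, Nat.zero_le _, Nat.zero_le _, by simp, hE' 0 _ _ 1 (h0 _) (h0 _),
      hE' 0 _ _ 1 (h0 _) (h0 _), ?_, ?_⟩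
    · simpa [hE1] using hA.le false huA
    · simp only [hE1, inv_one, one_mul, mul_one]
      have h1 := h false
      have h2 := conversionExcess_mono (D := n) hn0 hc hs
      unfold conversionExcess at h1 h2
      nlinarith [mul_nonneg hn0 (zero_le_one.trans (hpow n))]
  have hWlen : W.length ≤ n := hlen.trans hs
  -- Twice the bound on the length of W, since each end is compared with a representative of at most
  -- its own length.
  set D : ℝ := 2 * (n * (1 + c) ^ (n - W.length)) with hD
  have hWD : 2 * (altLength l b W : ℝ) ≤ D := by
    have h2 := conversionExcess_mono (D := n) hn0 hc
      (show s - W.length ≤ n - W.length by omega)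
    unfold conversionExcess at h h2
    rw [hD]; linarith
  have hnD : (n : ℝ) ≤ D := by
    have := le_mul_of_one_le_right hn0 (hpow (n - W.length))
    rw [hD]; linarith
  have hD0 : 0 ≤ D := hn0.trans hnD
  have hfin : D + conversionExcess D c W.length = 2 * n * (1 + c) ^ n := by
    unfold conversionExcess
    rw [hD]
    have : (1 + c) ^ n = (1 + c) ^ (n - W.length) * (1 + c) ^ W.length := by
      rw [← pow_add, Nat.sub_add_cancel hWlen]
    rw [this]; ring
  have hsuffix : ∀ {b₂ : Bool} {W₂ : List Γ} {m : Γ}, IsAlternating A S b₂ W₂ →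
      2 * (altLength l b₂ W₂ : ℝ) ≤ D → IsMinimalIn A S l W₂.prod⁻¹ m →
      W₂.prod * m ∈ A ∧ ∀ b', (l b' (W₂.prod * m) : ℝ) ≤
        2 * altLength l b₂ W₂ + conversionExcess D c W₂.length := by
    intro b₂ W₂ m hW₂ hb₂ hm
    obtain ⟨b', U, h1, h2, h3, h4⟩ := hW₂.exists_inv_append l hl.inv (V := []) trivial
    rw [List.append_nil] at h1 h4
    simp only [altLength, add_zero] at h4
    rw [← h3] at hm
    have := hl.length_minimal_le hA hcv hc hnD h1 hm (by rw [h4]; exact hb₂)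
    rwa [h3, inv_inv, h4, h2] at this
  rcases hA.exists_divergence hrep hW z with
    ⟨W₁, W₂, rfl, hz, hy⟩ | ⟨W₁, g, W₂, rfl, hz, hy⟩
  · have hu1 := hW.isPrefixCoset_left
    have hu2 := hW.isPrefixCoset_right
    obtain ⟨hW₁, b₂, hW₂, hsum⟩ := hW.append l
    rw [hsum, Nat.cast_add] at hWD
    have hp1 : (0 : ℝ) ≤ altLength l b W₁ := Nat.cast_nonneg _
    have hp2 : (0 : ℝ) ≤ altLength l b₂ W₂ := Nat.cast_nonneg _
    obtain ⟨h1, h1'⟩ := hl.length_minimal_le hA hcv hc hnD hW₁ (hE _ _ _ hu1) (by linarith)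
    obtain ⟨h2, h2'⟩ := hsuffix hW₂ (by linarith) (hE _ _ _ hu2)
    rw [List.length_append] at hWlen hfin
    have hg : (E W₁.length (W₁ ++ W₂).prod)⁻¹ * (W₁ ++ W₂).prod * E W₂.length (W₁ ++ W₂).prod⁻¹
        = (W₁.prod⁻¹ * E W₁.length (W₁ ++ W₂).prod)⁻¹ *
          (W₂.prod * E W₂.length (W₁ ++ W₂).prod⁻¹) := by
      rw [List.prod_append]; group
    -- A middle part in A is assigned to the type `false`. Type `true` then occurs only with a
    -- genuine middle letter, which forces k, k' < n.
    have hle := hA.le false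
    refine ⟨false, W₁.length, W₂.length, by omega, by omega, by simp, hE' _ _ _ _ hu1 hz,
      hE' _ _ _ _ hu2 hy, ?_, ?_⟩
    · rw [hg]; exact hle (A.mul_mem (A.inv_mem h1) h2)
    · rw [hg]
      have h3 := hl.mul_le false _ (hle (A.inv_mem h1)) _ (hle h2)
      rw [hl.inv false _ (hle h1)] at h3
      have h3' := (Nat.cast_le (α := ℝ)).2 h3
      rw [Nat.cast_add] at h3'
      have := conversionExcess_add hD0 hc W₁.length W₂.length
      linarith [h1' false, h2' false]
  · have hu1 := hW.isPrefixCoset_left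
    have hassoc : W₁ ++ g :: W₂ = (W₁ ++ [g]) ++ W₂ := by simp
    have hu2 : IsPrefixCoset A S W₂.length (W₁ ++ g :: W₂).prod⁻¹ W₂.prod⁻¹ := by
      rw [hassoc] at hW ⊢
      exact hW.isPrefixCoset_right
    obtain ⟨hW₁, b₂, hW₂, hsum⟩ := hW.append l
    rw [hsum, altLength, Nat.cast_add, Nat.cast_add] at hWD
    have hp1 : (0 : ℝ) ≤ altLength l b W₁ := Nat.cast_nonneg _
    have hp2 : (0 : ℝ) ≤ altLength l (!b₂) W₂ := Nat.cast_nonneg _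
    have hp3 : (0 : ℝ) ≤ l b₂ g := Nat.cast_nonneg _
    obtain ⟨h1, h1'⟩ := hl.length_minimal_le hA hcv hc hnD hW₁ (hE _ _ _ hu1) (by linarith)
    obtain ⟨h2, h2'⟩ := hsuffix hW₂.2.2 (by linarith) (hE _ _ _ hu2)
    rw [List.length_append, List.length_cons] at hWlen hfin
    have hg : (E W₁.length (W₁ ++ g :: W₂).prod)⁻¹ * (W₁ ++ g :: W₂).prod *
          E W₂.length (W₁ ++ g :: W₂).prod⁻¹
        = (W₁.prod⁻¹ * E W₁.length (W₁ ++ g :: W₂).prod)⁻¹ * g *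
          (W₂.prod * E W₂.length (W₁ ++ g :: W₂).prod⁻¹) := by
      rw [List.prod_append, List.prod_cons]; group
    have hle := hA.le b₂
    have h4 := (S b₂).mul_mem (hle (A.inv_mem h1)) hW₂.1
    refine ⟨b₂, W₁.length, W₂.length, by omega, by omega, fun _ => by omega, hE' _ _ _ _ hu1 hz,
      hE' _ _ _ _ hu2 hy, ?_, ?_⟩
    · rw [hg]; exact (S b₂).mul_mem h4 (hle h2)
    · rw [hg]
      have h3 := hl.mul_le b₂ _ h4 _ (hle h2)
      have h5 := hl.mul_le b₂ _ (hle (A.inv_mem h1)) _ hW₂.1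
      rw [hl.inv b₂ _ (hle h1)] at h5
      have h3' := (Nat.cast_le (α := ℝ)).2 (h3.trans (Nat.add_le_add_right h5 _))
      rw [Nat.cast_add, Nat.cast_add] at h3'
      have := conversionExcess_add hD0 hc W₁.length W₂.length
      have := conversionExcess_mono hD0 hc
        (show W₁.length + W₂.length ≤ W₁.length + (W₂.length + 1) by omega)
      linarith [h1' b₂, h2' b₂]

/-- The convolution bounds on balls in the subgroups `S b` give a convolution bound on the set of
elements of the whole group that have a short form. -/
theorem IsLengthPair.convolutionBound (hl : IsLengthPair A S l) (hA : IsAmalgamPair A S)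
    (hcv : ConversionBound A l n c) (hc : 0 ≤ c)
    (hrep : ∀ z, ∃ b Z, IsAlternating A S b Z ∧ ∃ a ∈ A, z = Z.prod * a) {C : ℝ≥0∞}
    (hC : ∀ b, ConvolutionBound {g | g ∈ S b ∧ (l b g : ℝ) ≤ 2 * n * (1 + c) ^ n} C) :
    ConvolutionBound {u | ∃ s ≤ n, HasShortForm A S l n c s u}
      (((n + 1) ^ 2 + n ^ 2 : ℕ) * C) := by
  obtain ⟨E, hE, hE'⟩ := hA.exists_marker hrep l
  let s : Finset (Bool × ℕ × ℕ) :=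
    (Finset.range (n + 1) ×ˢ Finset.range (n + 1)).map ⟨fun p => (false, p), by
      intro p q h; simpa using h⟩ ∪
    (Finset.range n ×ˢ Finset.range n).map ⟨fun p => (true, p), by
      intro p q h; simpa using h⟩
  have hcard : s.card = (n + 1) ^ 2 + n ^ 2 := by
    rw [Finset.card_union_of_disjoint]
    · simp [sq]
    · rw [Finset.disjoint_left]
      rintro ⟨b, p⟩ h1 h2
      simp only [Finset.mem_map] at h1 h2
      obtain ⟨_, _, h1, _⟩ := h1
      obtain ⟨_, _, h2, _⟩ := h2
  rw [← hcard]
  refine ConvolutionBound.of_markers s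
    (fun i => {g | g ∈ S i.1 ∧ (l i.1 g : ℝ) ≤ 2 * n * (1 + c) ^ n})
    (fun i => E i.2.1) (fun i => E i.2.2) (fun i _ => hC i.1) ?_
  rintro u ⟨r, hr, hu⟩ z
  obtain ⟨b, k, k', hk, hk', hb, h1, h2, h3, h4⟩ := hu.exists_markers hl hA hcv hc hrep hE hE' hr z
  refine ⟨(b, k, k'), ?_, h1, h2, h3, h4⟩
  cases b
  · refine Finset.mem_union_left _ ?_
    simp only [Finset.mem_map, Finset.mem_product, Finset.mem_range]
    exact ⟨(k, k'), ⟨by simp; omega, by simp; omega⟩, rfl⟩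
  · refine Finset.mem_union_right _ ?_
    simp only [Finset.mem_map, Finset.mem_product, Finset.mem_range]
    exact ⟨(k, k'), hb rfl, rfl⟩

end AmalgamDecay

/-! ## The universal length function -/

section UniversalLength

variable {A : Type v} {G H : Type u} [Group A] [Group G] [Group H] (iG : A →* G) (iH : A →* H)
  {LG : G → ℕ} {LH : H → ℕ}

theorem universalLength_le {w : List (G ⊕ H)} :
    universalLength iG iH LG LH (wordProd iG iH w) ≤ wordLength LG LH w :=
  Nat.sInf_le ⟨w, rfl, rfl⟩

theorem exists_word_of_universalLength (LG : G → ℕ) (LH : H → ℕ) (k : Amalgam iG iH) :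
    ∃ w : List (G ⊕ H), wordProd iG iH w = k ∧
      wordLength LG LH w = universalLength iG iH LG LH k := by
  obtain ⟨w, hw⟩ := exists_wordProd_eq iG iH k
  exact Nat.sInf_mem (s := {n | ∃ w : List (G ⊕ H), wordProd iG iH w = k ∧ wordLength LG LH w = n})
    ⟨_, w, hw, rfl⟩

theorem exists_inv_word (hLG : IsLengthFunction LG) (hLH : IsLengthFunction LH)
    (w : List (G ⊕ H)) : ∃ w', wordProd iG iH w' = (wordProd iG iH w)⁻¹ ∧
      wordLength LG LH w' = wordLength LG LH w := by
  induction w with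
  | nil => exact ⟨[], by simp [wordProd], rfl⟩
  | cons x w ih =>
    obtain ⟨w', h1, h2⟩ := ih
    simp only [wordProd, wordLength] at h1 h2
    refine ⟨w' ++ [Sum.map (·⁻¹) (·⁻¹) x], ?_, ?_⟩
    · cases x <;> simp [wordProd, h1]
    · cases x <;> simp [wordLength, h2, hLG.inv, hLH.inv, add_comm]

theorem isLengthFunction_universalLength (hLG : IsLengthFunction LG) (hLH : IsLengthFunction LH) :
    IsLengthFunction (universalLength iG iH LG LH) := by
  have hinv : ∀ k, universalLength iG iH LG LH k⁻¹ ≤ universalLength iG iH LG LH k := fun k => by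
    obtain ⟨w, rfl, h⟩ := exists_word_of_universalLength iG iH LG LH k
    obtain ⟨w', h1, h2⟩ := exists_inv_word iG iH hLG hLH w
    rw [← h, ← h1, ← h2]
    exact universalLength_le iG iH
  refine ⟨?_, fun k => (hinv k).antisymm (by simpa using hinv k⁻¹), fun k₁ k₂ => ?_⟩
  · have : universalLength iG iH LG LH (wordProd iG iH []) ≤ 0 := universalLength_le iG iH
    simpa [wordProd] using this
  · obtain ⟨w₁, rfl, h₁⟩ := exists_word_of_universalLength iG iH LG LH k₁
    obtain ⟨w₂, rfl, h₂⟩ := exists_word_of_universalLength iG iH LG LH k₂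
    rw [← h₁, ← h₂]
    have := universalLength_le iG iH (LG := LG) (LH := LH) (w := w₁ ++ w₂)
    simpa [wordProd, wordLength] using this

/-- The two length functions, as a family. -/
def pairLength (LG : G → ℕ) (LH : H → ℕ) : ∀ b, GroupPair G H b → ℕ
  | false => LG
  | true => LH

theorem isLengthFunction_pairLength (hLG : IsLengthFunction LG) (hLH : IsLengthFunction LH) :
    ∀ b, IsLengthFunction (pairLength LG LH b)
  | false => hLG
  | true => hLH

theorem hasDecay_pairLength {f : ℕ → ℝ} (hG : HasDecay LG f) (hH : HasDecay LH f) :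
    ∀ b, HasDecay (pairLength LG LH b) f
  | false => hG
  | true => hH

theorem pairHom_injective (hiG : Function.Injective iG) (hiH : Function.Injective iH) :
    ∀ b, Function.Injective (pairHom iG iH b)
  | false => hiG
  | true => hiH

/-- The image of the `b`-th group in the amalgam. -/
def amalgamFactor (b : Bool) : Subgroup (Amalgam iG iH) :=
  (Monoid.PushoutI.of (φ := pairHom iG iH) b).range

/-- The image in the amalgam of the common subgroup. -/
def amalgamBase : Subgroup (Amalgam iG iH) := (Monoid.PushoutI.base (pairHom iG iH)).range

/-- The length functions of the two groups, transported to their images in the amalgam. -/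
noncomputable def factorLength (LG : G → ℕ) (LH : H → ℕ) (b : Bool) (k : Amalgam iG iH) : ℕ :=
  pairLength LG LH b (Function.invFun (Monoid.PushoutI.of (φ := pairHom iG iH) b) k)

variable {iG iH}

theorem factorLength_of (hiG : Function.Injective iG) (hiH : Function.Injective iH) (b : Bool)
    (g : GroupPair G H b) :
    factorLength iG iH LG LH b (Monoid.PushoutI.of b g) = pairLength LG LH b g := by
  unfold factorLength
  rw [Function.leftInverse_invFun
    (Monoid.PushoutI.of_injective (pairHom_injective iG iH hiG hiH) b)]

theorem exists_reduced_list {b : Bool} {W : List (Amalgam iG iH)}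
    (hW : IsAlternating (amalgamBase iG iH) (amalgamFactor iG iH) b W) :
    ∃ w : List (Σ b, GroupPair G H b), w.IsChain (fun x y => x.1 ≠ y.1) ∧
      (∀ x ∈ w, x.2 ∉ (pairHom iG iH x.1).range) ∧
      (w.map fun x => (Monoid.PushoutI.of x.1 x.2 : Amalgam iG iH)).prod = W.prod ∧
      (∀ x ∈ w.head?, x.1 = b) ∧ w.length = W.length := by
  induction W generalizing b with
  | nil => exact ⟨[], by simp⟩
  | cons k W ih =>
    obtain ⟨⟨g, rfl⟩, h2, h3⟩ := hW
    obtain ⟨w, h4, h5, h6, h7, h8⟩ := ih h3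
    refine ⟨⟨b, g⟩ :: w, ?_, ?_, by simp [h6], by simp, by simp [h8]⟩
    · refine List.isChain_cons.2 ⟨fun y hy => ?_, h4⟩
      rw [h7 y hy]; simp
    · intro x hx
      rcases List.mem_cons.1 hx with rfl | hx
      · rintro ⟨a, ha⟩
        have ha' : pairHom iG iH b a = g := ha
        refine h2 ⟨a, ?_⟩
        rw [← ha', Monoid.PushoutI.of_apply_eq_base]
      · exact h5 x hx

/-- The normal form theorem for pushouts: a reduced word whose product lies in the base is empty. -/
theorem isAmalgamPair (hiG : Function.Injective iG) (hiH : Function.Injective iH) :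
    IsAmalgamPair (amalgamBase iG iH) (amalgamFactor iG iH) where
  le b := by
    rintro _ ⟨a, rfl⟩
    exact ⟨pairHom iG iH b a, Monoid.PushoutI.of_apply_eq_base (pairHom iG iH) b a⟩
  prod_notMem b W hW hne hmem := by
    obtain ⟨w, h1, h2, h3, -, h5⟩ := exists_reduced_list hW
    let w' : Monoid.CoprodI.Word (GroupPair G H) :=
      ⟨w, fun x hx h0 => h2 x hx (by rw [h0]; exact Subgroup.one_mem _), h1⟩
    have hprod : Monoid.PushoutI.ofCoprodI (φ := pairHom iG iH) w'.prod = W.prod := by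
      rw [← h3, Monoid.CoprodI.Word.prod, map_list_prod, List.map_map]
      congr 1
    have hred : Monoid.PushoutI.Reduced (pairHom iG iH) w' := h2
    have := hred.eq_empty_of_mem_range (pairHom_injective iG iH hiG hiH) (by rw [hprod]; exact hmem)
    have hw : w = [] := congrArg Monoid.CoprodI.Word.toList this
    rw [hw, List.length_nil, eq_comm, List.length_eq_zero_iff] at h5
    exact hne h5

theorem isLengthPair_factorLength (hiG : Function.Injective iG) (hiH : Function.Injective iH)
    (hLG : IsLengthFunction LG) (hLH : IsLengthFunction LH) (hz : ZerosInAmalgam iG iH LG LH) :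
    IsLengthPair (amalgamBase iG iH) (amalgamFactor iG iH) (factorLength iG iH LG LH) where
  one b := by
    rw [← map_one (Monoid.PushoutI.of (φ := pairHom iG iH) b), factorLength_of hiG hiH]
    exact (isLengthFunction_pairLength hLG hLH b).one
  inv b := by
    rintro _ ⟨g, rfl⟩
    rw [← map_inv, factorLength_of hiG hiH, factorLength_of hiG hiH]
    exact (isLengthFunction_pairLength hLG hLH b).inv g
  mul_le b := by
    rintro _ ⟨g, rfl⟩ _ ⟨h, rfl⟩
    rw [← map_mul]
    simp only [factorLength_of hiG hiH]
    exact (isLengthFunction_pairLength hLG hLH b).mul_le g h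
  zero b := by
    rintro _ ⟨g, rfl⟩ h0
    rw [factorLength_of hiG hiH] at h0
    have ha : ∃ a, pairHom iG iH b a = g := by
      cases b
      · exact hz.left g h0
      · exact hz.right g h0
    obtain ⟨a, rfl⟩ := ha
    rw [Monoid.PushoutI.of_apply_eq_base]
    refine ⟨⟨a, rfl⟩, ?_⟩
    rw [← Monoid.PushoutI.of_apply_eq_base (pairHom iG iH) (!b), factorLength_of hiG hiH]
    cases b
    · exact (hz.iff a).1 h0
    · exact (hz.iff a).2 h0

theorem exists_typed_word (hiG : Function.Injective iG) (hiH : Function.Injective iH)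
    (w : List (G ⊕ H)) : ∃ w' : List (Bool × Amalgam iG iH),
      (∀ p ∈ w', p.2 ∈ amalgamFactor iG iH p.1) ∧ (w'.map Prod.snd).prod = wordProd iG iH w ∧
      (w'.map fun p => factorLength iG iH LG LH p.1 p.2).sum = wordLength LG LH w := by
  induction w with
  | nil => exact ⟨[], by simp [wordProd, wordLength]⟩
  | cons x w ih =>
    obtain ⟨w', h1, h2, h3⟩ := ih
    cases x with
    | inl g =>
      refine ⟨(false, Amalgam.inG iG iH g) :: w', ?_, ?_, ?_⟩
      · rintro p hp
        rcases List.mem_cons.1 hp with rfl | hp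
        · exact ⟨g, rfl⟩
        · exact h1 p hp
      · simp [h2, wordProd]
      · simp only [List.map_cons, List.sum_cons, h3, wordLength, Sum.elim_inl]
        congr 1
        exact factorLength_of hiG hiH false g
    | inr g =>
      refine ⟨(true, Amalgam.inH iG iH g) :: w', ?_, ?_, ?_⟩
      · rintro p hp
        rcases List.mem_cons.1 hp with rfl | hp
        · exact ⟨g, rfl⟩
        · exact h1 p hp
      · simp [h2, wordProd]
      · simp only [List.map_cons, List.sum_cons, h3, wordLength, Sum.elim_inr]
        congr 1
        exact factorLength_of hiG hiH true g

/-- Take c = j(n)/n. For lengths k ≤ n monotonicity gives j(k) ≤ j(n) = cn; for k ≥ n the quotient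
condition gives j(k) ≤ ck. Then (1 + j(n)/n)ⁿ ≤ exp(j(n)). -/
theorem conversionBound_factorLength (hiG : Function.Injective iG) (hiH : Function.Injective iH)
    (hl : IsLengthPair (amalgamBase iG iH) (amalgamFactor iG iH) (factorLength iG iH LG LH)) {j : ℕ → ℝ} (hj : Monotone j)
    (hj' : AntitoneOn (fun n : ℕ => j n / n) (Set.Ici 1)) (hj0 : 0 ≤ j 0)
    (hd : IsDistorted (fun n => n + j n) (LG ∘ iG) (LH ∘ iH)) (n : ℕ) :
    ∃ c : ℝ, 0 ≤ c ∧ ConversionBound (amalgamBase iG iH) (factorLength iG iH LG LH) n c ∧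
      2 * n * (1 + c) ^ n ≤ 2 * (n * Real.exp (j n)) := by
  have hjn : ∀ m, 0 ≤ j m := fun m => hj0.trans (hj (Nat.zero_le m))
  have hle : ∀ b a, (factorLength iG iH LG LH (!b) (Monoid.PushoutI.base (pairHom iG iH) a) : ℝ)
      ≤ factorLength iG iH LG LH b (Monoid.PushoutI.base (pairHom iG iH) a)
        + j (factorLength iG iH LG LH b (Monoid.PushoutI.base (pairHom iG iH) a)) := by
    intro b a
    rw [← Monoid.PushoutI.of_apply_eq_base (pairHom iG iH) b, factorLength_of hiG hiH,
      Monoid.PushoutI.of_apply_eq_base, ← Monoid.PushoutI.of_apply_eq_base (pairHom iG iH) (!b),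
      factorLength_of hiG hiH]
    cases b
    · exact (hd a).2
    · exact (hd a).1
  have hj1 : ∀ {m k : ℕ}, 1 ≤ m → m ≤ k → j k ≤ j m / m * k := fun {m k} hm hk => by
    have h := hj' (Set.mem_Ici.2 hm) (Set.mem_Ici.2 (hm.trans hk)) hk
    have hk0 : (0 : ℝ) < k := by exact_mod_cast hm.trans hk
    exact (div_le_iff₀ hk0).1 h
  rcases Nat.eq_zero_or_pos n with rfl | hn
  -- For n = 0 the quotient j(n)/n is meaningless; c = j(1) gives j(k) ≤ ck for k ≥ 1, and elements
  -- of length zero have length zero on both sides.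
  · refine ⟨j 1, hjn 1, ?_, by simp⟩
    rintro b _ ⟨a, rfl⟩
    set k := factorLength iG iH LG LH b (Monoid.PushoutI.base (pairHom iG iH) a) with hk
    rcases Nat.eq_zero_or_pos k with h0 | hpos
    · have := (hl.zero b _ ((isAmalgamPair hiG hiH).le b ⟨a, rfl⟩) h0).2
      simp [this, h0]
    · have h1 := hj1 le_rfl hpos
      have h2 := hle b a
      rw [← hk] at h2
      rw [Nat.cast_zero, max_eq_left (Nat.cast_nonneg k)]
      norm_num at h1
      linarith
  · have hn0 : (0 : ℝ) < n := by exact_mod_cast hn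
    refine ⟨j n / n, div_nonneg (hjn n) hn0.le, ?_, ?_⟩
    · rintro b _ ⟨a, rfl⟩
      set k := factorLength iG iH LG LH b (Monoid.PushoutI.base (pairHom iG iH) a) with hk
      refine (hle b a).trans ?_
      rw [← hk]
      gcongr
      rcases le_total k n with h | h
      · rw [max_eq_right (by exact_mod_cast h), div_mul_cancel₀ _ hn0.ne']
        exact hj h
      · rw [max_eq_left (by exact_mod_cast h)]
        exact hj1 hn h
    · have h1 : (1 + j n / n) ^ n ≤ Real.exp (j n) := by
        calc (1 + j n / n) ^ n ≤ Real.exp (j n / n) ^ n := by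
              have := div_nonneg (hjn n) hn0.le
              gcongr
              rw [add_comm]
              exact Real.add_one_le_exp _
          _ = Real.exp (j n) := by
              rw [← Real.exp_nat_mul, mul_div_cancel₀ _ hn0.ne']
      rw [mul_assoc]
      gcongr

open Classical in
/-- A length function increased by one away from the identity. -/
noncomputable def positiveLength {K : Type*} [Group K] (L : K → ℕ) (k : K) : ℕ :=
  L k + if k = 1 then 0 else 1

theorem IsLengthFunction.positiveLength {K : Type*} [Group K] {L : K → ℕ}
    (hL : IsLengthFunction L) : IsLengthFunction (positiveLength L) where
  one := by simp [_root_.positiveLength, hL.one]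
  inv k := by by_cases h : k = 1 <;> simp [_root_.positiveLength, hL.inv, h]
  mul_le k k' := by
    have := hL.mul_le k k'
    unfold _root_.positiveLength
    by_cases h : k = 1
    · subst h; rw [one_mul]; exact Nat.le_add_left _ _
    · rw [if_neg h]
      split_ifs <;> omega

theorem positiveLength_eq_zero {K : Type*} [Group K] {L : K → ℕ} (hL : IsLengthFunction L)
    {k : K} : positiveLength L k = 0 ↔ k = 1 := by
  unfold positiveLength
  by_cases h : k = 1 <;> simp [h, hL.one]

theorem zerosInAmalgam_positiveLength (hiG : Function.Injective iG) (hiH : Function.Injective iH)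
    (hLG : IsLengthFunction LG) (hLH : IsLengthFunction LH) :
    ZerosInAmalgam iG iH (positiveLength LG) (positiveLength LH) where
  left g h := ⟨1, by rw [(positiveLength_eq_zero hLG).1 h, map_one]⟩
  right g h := ⟨1, by rw [(positiveLength_eq_zero hLH).1 h, map_one]⟩
  iff a := by
    rw [positiveLength_eq_zero hLG, positiveLength_eq_zero hLH, map_eq_one_iff iG hiG,
      map_eq_one_iff iH hiH]


/-- The rewriting in `IsLengthPair.hasShortForm`, run with the length that is 1 off the identity on
both factors, already produces normal forms; this length is undistorted, so j = 0 serves. -/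
theorem exists_alternating_rep (hiG : Function.Injective iG) (hiH : Function.Injective iH)
    (z : Amalgam iG iH) :
    ∃ b Z, IsAlternating (amalgamBase iG iH) (amalgamFactor iG iH) b Z ∧
      ∃ a ∈ amalgamBase iG iH, z = Z.prod * a := by
  have h0 : ∀ K : Type u, [Group K] → IsLengthFunction (fun _ : K => 0) := fun K _ =>
    ⟨rfl, fun _ => rfl, fun _ _ => le_rfl⟩
  have hl := isLengthPair_factorLength hiG hiH (h0 G).positiveLength (h0 H).positiveLength
    (zerosInAmalgam_positiveLength hiG hiH (h0 G) (h0 H))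
  obtain ⟨w, rfl⟩ := exists_wordProd_eq iG iH z
  obtain ⟨w', h1, h2, -⟩ := exists_typed_word (LG := positiveLength fun _ : G => 0)
    (LH := positiveLength fun _ : H => 0) hiG hiH w
  have hd : IsDistorted (fun n : ℕ => (n : ℝ) + (fun _ => 0 : ℕ → ℝ) n)
      ((positiveLength fun _ : G => 0) ∘ iG) ((positiveLength fun _ : H => 0) ∘ iH) := fun a => by
    by_cases ha : a = 1
    · simp [positiveLength, ha]
    · simp [positiveLength, map_eq_one_iff iG hiG, map_eq_one_iff iH hiH, ha]
  obtain ⟨c, hc, hcv, -⟩ := conversionBound_factorLength hiG hiH hl (j := fun _ => 0)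
    monotone_const (fun m _ n _ _ => by simp) le_rfl hd
    (w'.map fun p => factorLength iG iH (positiveLength fun _ : G => 0)
      (positiveLength fun _ : H => 0) p.1 p.2).sum
  rcases hl.hasShortForm (isAmalgamPair hiG hiH) hcv hc w' h1 le_rfl with
    ⟨h, -⟩ | ⟨b, W, hW, -, -, hWz, -⟩
  · exact ⟨false, [], trivial, _, by rwa [h2] at h, by simp⟩
  · exact ⟨b, W, hW, 1, Subgroup.one_mem _, by rw [hWz, h2, mul_one]⟩

theorem universalLength_hasDecay (hiG : Function.Injective iG) (hiH : Function.Injective iH)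
    (hLG : IsLengthFunction LG) (hLH : IsLengthFunction LH) (hz : ZerosInAmalgam iG iH LG LH)
    {f j : ℕ → ℝ} (hj : Monotone j) (hj' : AntitoneOn (fun n : ℕ => j n / n) (Set.Ici 1))
    (hd : IsDistorted (fun n => n + j n) (LG ∘ iG) (LH ∘ iH))
    (hG : HasDecay LG f) (hH : HasDecay LH f) :
    HasDecay (universalLength iG iH LG LH) (fun n => decayTilde f (n * Real.exp (j n))) := by
  intro n x hx
  -- Evaluate the distortion inequality at the identity.
  have hj0 : 0 ≤ j 0 := by
    have := (hd 1).1
    simpa [hLG.one, hLH.one] using this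
  have hl := isLengthPair_factorLength hiG hiH hLG hLH hz
  obtain ⟨c, hc, hcv, hcn⟩ := conversionBound_factorLength hiG hiH hl hj hj' hj0 hd n
  have hA := isAmalgamPair hiG hiH
  set N := ⌊2 * (n * Real.exp (j n))⌋₊ with hN
  have hfN : 0 ≤ f N := hG.nonneg hLG.one N
  have hC : ∀ b, ConvolutionBound {g | g ∈ amalgamFactor iG iH b ∧
      (factorLength iG iH LG LH b g : ℝ) ≤ 2 * n * (1 + c) ^ n} (ENNReal.ofReal (f N)) := by
    intro b
    refine (((hasDecay_pairLength hG hH b).convolutionBound N).map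
      (Monoid.PushoutI.of (φ := pairHom iG iH) b)
      (Monoid.PushoutI.of_injective (pairHom_injective iG iH hiG hiH) b)).mono ?_
    rintro _ ⟨⟨g, rfl⟩, h⟩
    rw [factorLength_of hiG hiH] at h
    exact ⟨g, Nat.le_floor (h.trans hcn), rfl⟩
  have hmain := hl.convolutionBound hA hcv hc (exists_alternating_rep hiG hiH) hC
  have hreal : (((n + 1) ^ 2 + n ^ 2 : ℕ) : ℝ≥0∞) * ENNReal.ofReal (f N)
      = ENNReal.ofReal ((((n + 1) ^ 2 + n ^ 2 : ℕ) : ℝ) * f N) := by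
    rw [ENNReal.ofReal_mul (Nat.cast_nonneg _), ENNReal.ofReal_natCast]
  rw [hreal] at hmain
  refine (hmain.norm_regularRep_le (mul_nonneg (Nat.cast_nonneg _) hfN) x fun g hg => ?_).trans ?_
  · obtain ⟨w, hw, hwl⟩ := exists_word_of_universalLength iG iH LG LH g
    obtain ⟨w', h1, h2, h3⟩ := exists_typed_word (LG := LG) (LH := LH) hiG hiH w
    have hle : (w'.map fun p => factorLength iG iH LG LH p.1 p.2).sum ≤ n := by
      rw [h3, hwl]; exact hx g hg
    have := hl.hasShortForm hA hcv hc w' h1 hle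
    rw [h2, hw] at this
    exact ⟨_, hle, this⟩
  · refine mul_le_mul_of_nonneg_right ?_ (twoNorm_nonneg x)
    change _ ≤ (2 * (n * Real.exp (j n)) + 1) ^ (7 / 2 : ℝ) * f N
    refine mul_le_mul_of_nonneg_right ?_ hfN
    have hn0 : (0 : ℝ) ≤ n := n.cast_nonneg
    have h1 : (n : ℝ) ≤ n * Real.exp (j n) :=
      le_mul_of_one_le_right hn0 (Real.one_le_exp (hj0.trans (hj (Nat.zero_le n))))
    calc (((n + 1) ^ 2 + n ^ 2 : ℕ) : ℝ) ≤ (2 * (n * Real.exp (j n)) + 1) ^ 2 := by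
          push_cast; nlinarith
      _ = (2 * (n * Real.exp (j n)) + 1) ^ (2 : ℝ) := by norm_cast
      _ ≤ (2 * (n * Real.exp (j n)) + 1) ^ (7 / 2 : ℝ) :=
          Real.rpow_le_rpow_of_exponent_le (by linarith) (by norm_num)

end UniversalLength

/-! ## Growth of decay functions -/

section Growth

theorem HasDecay.mono {K : Type*} [Group K] {l : K → ℕ} {f g : ℕ → ℝ} (h : HasDecay l f)
    (hfg : ∀ n, f n ≤ g n) : HasDecay l g := fun n x hx =>
  (h n x hx).trans (mul_le_mul_of_nonneg_right (hfg n) (twoNorm_nonneg x))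

theorem HasDecay.mono_length {K : Type*} [Group K] {l l' : K → ℕ} {f : ℕ → ℝ} (h : HasDecay l f)
    (hl : ∀ k, l k ≤ l' k) : HasDecay l' f := fun n x hx =>
  h n x fun g hg => (hl g).trans (hx g hg)

/-- Absolute values of the coefficients give a nonnegative, nondecreasing bound, into which larger
radii may be substituted. -/
theorem HasRDWith.exists_pow {K : Type*} [Group K] {l : K → ℕ} (h : HasRDWith l) :
    ∃ M : ℝ, 0 ≤ M ∧ ∃ d : ℕ, HasDecay l fun n => M * (n + 1) ^ d := by
  obtain ⟨p, hp⟩ := h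
  refine ⟨∑ i ∈ Finset.range (p.natDegree + 1), |p.coeff i|,
    Finset.sum_nonneg fun _ _ => abs_nonneg _, p.natDegree, hp.mono fun n => ?_⟩
  rw [Polynomial.eval_eq_sum_range, Finset.sum_mul]
  refine Finset.sum_le_sum fun i hi => ?_
  have hn : (0 : ℝ) ≤ n := n.cast_nonneg
  have h1 : (n : ℝ) ^ i ≤ (n + 1) ^ p.natDegree :=
    (pow_le_pow_left₀ hn (by linarith) i).trans
      (pow_le_pow_right₀ (by linarith) (by simpa [Nat.lt_succ_iff] using hi))
  calc p.coeff i * (n : ℝ) ^ i ≤ |p.coeff i| * (n : ℝ) ^ i := by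
        gcongr; exact le_abs_self _
    _ ≤ _ := by gcongr

theorem HasRDWith.exists_common_pow {K K' : Type*} [Group K] [Group K'] {l : K → ℕ} {l' : K' → ℕ}
    (h : HasRDWith l) (h' : HasRDWith l') : ∃ M : ℝ, 0 ≤ M ∧ ∃ d : ℕ,
      HasDecay l (fun n => M * (n + 1) ^ d) ∧ HasDecay l' fun n => M * (n + 1) ^ d := by
  obtain ⟨M, hM, d, h⟩ := h.exists_pow
  obtain ⟨M', hM', d', h'⟩ := h'.exists_pow
  have h1 : ∀ n : ℕ, (1 : ℝ) ≤ n + 1 := fun n => by linarith [n.cast_nonneg (α := ℝ)]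
  refine ⟨max M M', hM.trans (le_max_left _ _), max d d', h.mono fun n => ?_, h'.mono fun n => ?_⟩
  · exact mul_le_mul (le_max_left _ _) (pow_le_pow_right₀ (h1 n) (le_max_left _ _))
      (by positivity) (hM.trans (le_max_left _ _))
  · exact mul_le_mul (le_max_right _ _) (pow_le_pow_right₀ (h1 n) (le_max_right _ _))
      (by positivity) (hM.trans (le_max_left _ _))

theorem decayTilde_le (f : ℕ → ℝ) {x : ℝ} (hx : 0 ≤ x) (hf : 0 ≤ f ⌊2 * x⌋₊) :
    decayTilde f x ≤ (2 * x + 1) ^ 4 * f ⌊2 * x⌋₊ := by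
  unfold decayTilde
  gcongr
  calc (2 * x + 1) ^ (7 / 2 : ℝ) ≤ (2 * x + 1) ^ (4 : ℝ) :=
        Real.rpow_le_rpow_of_exponent_le (by linarith) (by norm_num)
    _ = (2 * x + 1) ^ 4 := by norm_cast

theorem decayTilde_pow_le {M : ℝ} (hM : 0 ≤ M) (d : ℕ) {x y : ℝ} (hx : 0 ≤ x) (hxy : x ≤ y) :
    decayTilde (fun n => M * (n + 1) ^ d) x ≤ M * (2 * y + 1) ^ (d + 4) := by
  refine (decayTilde_le _ hx (by positivity)).trans ?_
  have h1 : (⌊2 * x⌋₊ : ℝ) ≤ 2 * x := Nat.floor_le (by positivity)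
  calc (2 * x + 1) ^ 4 * (M * ((⌊2 * x⌋₊ : ℝ) + 1) ^ d)
      ≤ (2 * y + 1) ^ 4 * (M * (2 * y + 1) ^ d) := by gcongr; linarith
    _ = M * (2 * y + 1) ^ (d + 4) := by ring

theorem exists_forall_le_add {j g : ℕ → ℝ} (h : ∀ᶠ n in atTop, j n ≤ g n) :
    ∃ C, 0 ≤ C ∧ ∀ n, j n ≤ g n + C := by
  obtain ⟨N, hN⟩ := eventually_atTop.1 h
  refine ⟨∑ n ∈ Finset.range N, |j n - g n|, Finset.sum_nonneg fun _ _ => abs_nonneg _,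
    fun n => ?_⟩
  rcases lt_or_ge n N with hn | hn
  · have := Finset.single_le_sum (f := fun n => |j n - g n|) (fun _ _ => abs_nonneg _)
      (Finset.mem_range.2 hn)
    have h2 := le_abs_self (j n - g n)
    linarith
  · have : 0 ≤ ∑ n ∈ Finset.range N, |j n - g n| := Finset.sum_nonneg fun _ _ => abs_nonneg _
    linarith [hN n hn]

theorem eventually_mul_pow_le_exp (a : ℝ) (d : ℕ) {ε : ℝ} (hε : 0 < ε) :
    ∀ᶠ n : ℕ in atTop, a * (2 * n + 1) ^ d ≤ Real.exp (ε * n) := by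
  have h := (isLittleO_pow_exp_pos_mul_atTop d hε).comp_tendsto tendsto_natCast_atTop_atTop
  have h2 := h.bound (c := 1 / ((|a| + 1) * 3 ^ d)) (by positivity)
  filter_upwards [h2, eventually_ge_atTop 1] with n hn hn1
  have hn1' : (1 : ℝ) ≤ n := by exact_mod_cast hn1
  simp only [Function.comp_apply, Real.norm_eq_abs, Real.abs_exp, abs_pow, Nat.abs_cast] at hn
  rw [one_div_mul_eq_div, le_div_iff₀ (by positivity)] at hn
  calc a * (2 * (n : ℝ) + 1) ^ d ≤ (|a| + 1) * (3 * n) ^ d := by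
        gcongr
        · linarith [le_abs_self a]
        · linarith
    _ = (n : ℝ) ^ d * ((|a| + 1) * 3 ^ d) := by rw [mul_pow]; ring
    _ ≤ _ := hn

theorem hasSDWith_of_eventually_le {K : Type*} [Group K] {l : K → ℕ} {f : ℕ → ℝ}
    (h : HasDecay l f) (hf : ∀ ε > 0, ∀ᶠ n : ℕ in atTop, f n ≤ Real.exp (ε * n)) :
    HasSDWith l := by
  -- The maximum with 1 keeps all n-th roots at least 1, so only the upper bound needs the
  -- hypothesis.
  refine ⟨fun n => max 1 (f n), ⟨fun n => zero_le_one.trans (le_max_left _ _), ?_⟩,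
    h.mono fun n => le_max_right _ _⟩
  have h1 : ∀ n, 1 ≤ (max 1 (f n)) ^ (1 / (n : ℝ)) := fun n =>
    Real.one_le_rpow (le_max_left _ _) (by positivity)
  refine tendsto_order.2 ⟨fun a ha => Eventually.of_forall fun n => ha.trans_le (h1 n),
    fun a ha => ?_⟩
  have hε : 0 < Real.log a / 2 := half_pos (Real.log_pos ha)
  filter_upwards [hf _ hε, eventually_ge_atTop 1] with n hn hn1
  have hn0 : (0 : ℝ) < n := by exact_mod_cast hn1
  have h2 : max 1 (f n) ≤ Real.exp (Real.log a / 2 * n) :=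
    max_le (Real.one_le_exp (by positivity)) hn
  calc (max 1 (f n)) ^ (1 / (n : ℝ)) ≤ Real.exp (Real.log a / 2 * n) ^ (1 / (n : ℝ)) :=
        Real.rpow_le_rpow (zero_le_one.trans (le_max_left _ _)) h2 (by positivity)
    _ = Real.exp (Real.log a / 2) := by
        rw [← Real.exp_mul]; congr 1; field_simp
    _ < Real.exp (Real.log a) := Real.exp_lt_exp.2 (half_lt_self (Real.log_pos ha))
    _ = a := Real.exp_log (zero_lt_one.trans ha)

theorem IsSubexponential.eventually_le {f : ℕ → ℝ} (h : IsSubexponential f) {ε : ℝ}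
    (hε : 0 < ε) : ∀ᶠ n : ℕ in atTop, f n ≤ Real.exp (ε * n) := by
  have h1 := h.2.eventually (eventually_lt_nhds (Real.one_lt_exp_iff.2 hε))
  filter_upwards [h1, eventually_ge_atTop 1] with n hn hn1
  have hn0 : (n : ℝ) ≠ 0 := by positivity
  calc f n = (f n ^ (1 / (n : ℝ))) ^ (n : ℝ) := by
        rw [← Real.rpow_mul (h.1 n), one_div_mul_cancel hn0, Real.rpow_one]
    _ ≤ Real.exp ε ^ (n : ℝ) :=
        Real.rpow_le_rpow (Real.rpow_nonneg (h.1 n) _) hn.le (Nat.cast_nonneg _)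
    _ = Real.exp (ε * n) := by rw [← Real.exp_mul]

end Growth

/-! ## Distortion -/

section Distortion

variable {A : Type v} {G H : Type u} [Group A] [Group G] [Group H] {iG : A →* G} {iH : A →* H}
  {LG : G → ℕ} {LH : H → ℕ}

theorem IsDistorted.mono {K : Type*} [Group K] {l₁ l₂ : K → ℕ} {j j' : ℕ → ℝ}
    (h : IsDistorted (fun n => n + j n) l₁ l₂) (hj : ∀ n, j n ≤ j' n) :
    IsDistorted (fun n => n + j' n) l₁ l₂ := fun k =>
  ⟨(h k).1.trans (add_le_add le_rfl (hj _)), (h k).2.trans (add_le_add le_rfl (hj _))⟩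

/-- With a regular distortion function, the universal length of the given length functions, or of
these length functions made positive, has the decay of the general estimate. -/
theorem hasDecay_positive_and (hiG : Function.Injective iG) (hiH : Function.Injective iH)
    (hLG : IsLengthFunction LG) (hLH : IsLengthFunction LH) {f j : ℕ → ℝ} (hj : Monotone j)
    (hj' : AntitoneOn (fun n : ℕ => j n / n) (Set.Ici 1))
    (hd : IsDistorted (fun n => n + j n) (LG ∘ iG) (LH ∘ iH))
    (hG : HasDecay LG f) (hH : HasDecay LH f) :
    HasDecay (universalLength iG iH (positiveLength LG) (positiveLength LH))
        (fun n => decayTilde f (n * Real.exp (j n))) ∧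
      (ZerosInAmalgam iG iH LG LH → HasDecay (universalLength iG iH LG LH)
        (fun n => decayTilde f (n * Real.exp (j n)))) := by
  refine ⟨?_, fun hz => universalLength_hasDecay hiG hiH hLG hLH hz hj hj' hd hG hH⟩
  refine universalLength_hasDecay hiG hiH hLG.positiveLength hLH.positiveLength
    (zerosInAmalgam_positiveLength hiG hiH hLG hLH) hj hj' (fun a => ?_)
    (hG.mono_length fun _ => Nat.le_add_right _ _) (hH.mono_length fun _ => Nat.le_add_right _ _)
  have h := hd a
  simp only [Function.comp_apply] at h ⊢
  by_cases ha : a = 1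
  · have h0 := hd 1
    simp only [Function.comp_apply, map_one, hLG.one, hLH.one] at h0
    simpa [ha, hLG.one, hLH.one, positiveLength] using h0.1
  · have h1 : positiveLength LG (iG a) = LG (iG a) + 1 := by
      simp [positiveLength, map_eq_one_iff iG hiG, ha]
    have h2 : positiveLength LH (iH a) = LH (iH a) + 1 := by
      simp [positiveLength, map_eq_one_iff iH hiH, ha]
    rw [h1, h2]
    -- Both lengths grow by one; monotonicity of j absorbs the shift of its argument.
    have h3 := hj (Nat.le_succ (LG (iG a)))
    have h4 := hj (Nat.le_succ (LH (iH a)))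
    simp only [Nat.succ_eq_add_one] at h3 h4
    push_cast
    constructor <;> linarith [h.1, h.2]

theorem hasRD_amalgam (hiG : Function.Injective iG) (hiH : Function.Injective iH)
    (hLG : IsLengthFunction LG) (hLH : IsLengthFunction LH) {j : ℕ → ℝ}
    (hd : IsDistorted (fun n => n + j n) (LG ∘ iG) (LH ∘ iH))
    (hj : j =O[atTop] (fun n : ℕ => Real.log n)) (hG : HasRDWith LG) (hH : HasRDWith LH) :
    HasRD (Amalgam iG iH) ∧
      (ZerosInAmalgam iG iH LG LH → HasRDWith (universalLength iG iH LG LH)) := by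
  obtain ⟨M, hM, d, hG, hH⟩ := hG.exists_common_pow hH
  obtain ⟨C, hC⟩ := hj.bound
  obtain ⟨C', -, hC'⟩ := exists_forall_le_add (j := j) (g := fun n => C * ‖Real.log n‖)
    (hC.mono fun n hn => (le_abs_self _).trans hn)
  obtain ⟨k, hk⟩ := exists_nat_ge (max C C')
  have hlog : ∀ n : ℕ, 0 ≤ Real.log n := fun n => Real.log_natCast_nonneg n
  have hjk : ∀ n, j n ≤ k * (1 + Real.log n) := fun n => by
    have h1 := hC' n
    simp only [Real.norm_of_nonneg (hlog n)] at h1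
    have h2 := mul_le_mul_of_nonneg_right ((le_max_left C C').trans hk) (hlog n)
    linarith [(le_max_right C C').trans hk]
  have hmono : Monotone fun n : ℕ => (k : ℝ) * (1 + Real.log n) := by
    intro m n hmn
    rcases Nat.eq_zero_or_pos m with rfl | hm
    · have := mul_nonneg k.cast_nonneg (hlog n)
      -- With `Real.log 0 = 0` the majorant takes its minimal value k at zero.
      simp only [Nat.cast_zero, Real.log_zero]
      linarith
    · have : (0 : ℝ) < m := by exact_mod_cast hm
      dsimp only
      gcongr
  have hanti : AntitoneOn (fun n : ℕ => (k : ℝ) * (1 + Real.log n) / n) (Set.Ici 1) := by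
    intro m hm n hn hmn
    have hm0 : (0 : ℝ) < m := by exact_mod_cast Set.mem_Ici.1 hm
    have hn0 : (0 : ℝ) < n := by exact_mod_cast Set.mem_Ici.1 hn
    have hmn' : (m : ℝ) ≤ n := by exact_mod_cast hmn
    simp only
    rw [div_le_div_iff₀ hn0 hm0, mul_assoc, mul_assoc]
    refine mul_le_mul_of_nonneg_left ?_ k.cast_nonneg
    have h1 : Real.log n ≤ Real.log m + (n / m - 1) := by
      have := Real.log_le_sub_one_of_pos (div_pos hn0 hm0)
      rw [Real.log_div hn0.ne' hm0.ne'] at this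
      linarith
    calc (1 + Real.log n) * (m : ℝ) ≤ (Real.log m + n / m) * m :=
          mul_le_mul_of_nonneg_right (by linarith) hm0.le
      _ = Real.log m * m + n := by field_simp
      _ ≤ (1 + Real.log m) * n := by nlinarith [mul_le_mul_of_nonneg_left hmn' (hlog m)]
  have key : ∀ {l : Amalgam iG iH → ℕ}, HasDecay l
      (fun n => decayTilde (fun n => M * (n + 1) ^ d)
        (n * Real.exp (k * (1 + Real.log n)))) → HasRDWith l := by
    intro l hl
    refine ⟨Polynomial.C M * (2 * (Polynomial.C (Real.exp k) * Polynomial.X ^ (k + 1)) + 1) ^ (d + 4),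
      hl.mono fun n => ?_⟩
    -- A natural number k makes exp(k ln n) the monomial nᵏ, so the resulting bound is a polynomial.
    have hx : (n : ℝ) * Real.exp (k * (1 + Real.log n)) ≤ Real.exp k * (n : ℝ) ^ (k + 1) := by
      rcases Nat.eq_zero_or_pos n with rfl | hn
      · simp
      · have hn0 : (0 : ℝ) < n := by exact_mod_cast hn
        rw [mul_add, mul_one, Real.exp_add, Real.exp_nat_mul (Real.log n), Real.exp_log hn0]
        exact le_of_eq (by ring)
    simpa using decayTilde_pow_le hM d (by positivity) hx
  obtain ⟨h1, h2⟩ := hasDecay_positive_and hiG hiH hLG hLH hmono hanti (hd.mono hjk) hG hH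
  exact ⟨⟨_, isLengthFunction_universalLength iG iH hLG.positiveLength hLH.positiveLength, key h1⟩,
    fun hz => key (h2 hz)⟩

/-- A sublinear function lies below a sublinear, nondecreasing function `j'` for which `j' n / n` is
nonincreasing. -/
theorem exists_regular_sublinear {j : ℕ → ℝ} (hj : j =o[atTop] (fun n : ℕ => (n : ℝ))) :
    ∃ j' : ℕ → ℝ, (∀ n, j n ≤ j' n) ∧ Monotone j' ∧
      AntitoneOn (fun n : ℕ => j' n / n) (Set.Ici 1) ∧
      ∀ ε > 0, ∃ C, ∀ n : ℕ, j' n ≤ ε * n + C := by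
  have h1 : ∀ k : ℕ, ∃ C, 0 ≤ C ∧ ∀ n : ℕ, j n ≤ 1 / ((k : ℝ) + 1) * n + C := fun k =>
    exists_forall_le_add ((hj.bound (c := 1 / ((k : ℝ) + 1)) (by positivity)).mono
      fun n hn => (le_abs_self _).trans (by simpa using hn))
  choose C hC0 hC using h1
  have hbdd : ∀ n : ℕ, BddBelow (Set.range fun k : ℕ => 1 / ((k : ℝ) + 1) * n + C k) := fun n =>
    ⟨0, by rintro _ ⟨k, rfl⟩; have := hC0 k; positivity⟩
  -- The infimum of affine majorants of j with slopes 1/(k+1) and constants `C k` ≥ 0. Each is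
  -- nondecreasing with nonincreasing quotient by n, and both properties pass to the infimum.
  refine ⟨fun n => ⨅ k : ℕ, (1 / ((k : ℝ) + 1) * n + C k), fun n => le_ciInf fun k => hC k n,
    fun m n hmn => ciInf_mono (hbdd m) fun k => ?_, fun m hm n hn hmn => ?_, fun ε hε => ?_⟩
  · have : (m : ℝ) ≤ n := by exact_mod_cast hmn
    gcongr
  · have hm0 : (0 : ℝ) < m := by exact_mod_cast Set.mem_Ici.1 hm
    have hn0 : (0 : ℝ) < n := by exact_mod_cast Set.mem_Ici.1 hn
    have hmn' : (m : ℝ) ≤ n := by exact_mod_cast hmn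
    simp only
    rw [div_le_div_iff₀ hn0 hm0, ← le_div_iff₀ hm0, mul_div_assoc, ← div_le_iff₀ (by positivity)]
    refine le_ciInf fun k => ?_
    rw [div_le_iff₀ (by positivity)]
    refine (ciInf_le (hbdd n) k).trans ?_
    have h2 : C k ≤ C k * (n / m) := le_mul_of_one_le_right (hC0 k) ((one_le_div hm0).2 hmn')
    have h3 : 1 / ((k : ℝ) + 1) * m * (n / m) = 1 / ((k : ℝ) + 1) * n := by field_simp
    rw [add_mul, h3]
    linarith
  · obtain ⟨k, hk⟩ := exists_nat_one_div_lt hε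
    refine ⟨C k, fun n => (ciInf_le (hbdd n) k).trans ?_⟩
    gcongr

theorem hasSD_amalgam_of_sublinear (hiG : Function.Injective iG) (hiH : Function.Injective iH)
    (hLG : IsLengthFunction LG) (hLH : IsLengthFunction LH) {j : ℕ → ℝ}
    (hd : IsDistorted (fun n => n + j n) (LG ∘ iG) (LH ∘ iH))
    (hj : j =o[atTop] (fun n : ℕ => (n : ℝ))) (hG : HasRDWith LG) (hH : HasRDWith LH) :
    HasSD (Amalgam iG iH) ∧
      (ZerosInAmalgam iG iH LG LH → HasSDWith (universalLength iG iH LG LH)) := by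
  obtain ⟨M, hM, d, hG, hH⟩ := hG.exists_common_pow hH
  obtain ⟨j', hjj', hmono, hanti, hj'⟩ := exists_regular_sublinear hj
  have key : ∀ {l : Amalgam iG iH → ℕ}, HasDecay l
      (fun n => decayTilde (fun n => M * (n + 1) ^ d) (n * Real.exp (j' n))) → HasSDWith l := by
    intro l hl
    refine hasSDWith_of_eventually_le hl fun ε hε => ?_
    -- The exponential is raised to the power d + 4; this slope turns it into exp(εn/2), leaving ε/2
    -- for the polynomial factor.
    obtain ⟨C, hC⟩ := hj' (ε / 2 / (d + 4)) (by positivity)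
    have hC1 : ∀ n, j' n ≤ ε / 2 / (d + 4) * n + max C 0 := fun n =>
      (hC n).trans (by gcongr; exact le_max_left _ _)
    filter_upwards [eventually_mul_pow_le_exp (M * Real.exp (max C 0) ^ (d + 4)) (d + 4)
      (half_pos hε)] with n hn
    have hn0 : (0 : ℝ) ≤ n := n.cast_nonneg
    set t := ε / 2 / (d + 4) * n + max C 0 with ht
    have ht0 : 0 ≤ t := by have := le_max_right C 0; positivity
    have h1 : 2 * (n * Real.exp t) + 1 ≤ (2 * n + 1) * Real.exp t := by
      linarith [Real.one_le_exp ht0]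
    calc decayTilde (fun n => M * (n + 1) ^ d) (n * Real.exp (j' n))
        ≤ M * (2 * (n * Real.exp t) + 1) ^ (d + 4) :=
          decayTilde_pow_le hM d (by positivity) (by gcongr; exact hC1 n)
      _ ≤ M * ((2 * n + 1) * Real.exp t) ^ (d + 4) := by gcongr
      _ = M * Real.exp (max C 0) ^ (d + 4) * (2 * n + 1) ^ (d + 4) *
            Real.exp (ε / 2 / (d + 4) * n) ^ (d + 4) := by
          rw [ht, Real.exp_add, mul_pow, mul_pow]; ring
      _ = M * Real.exp (max C 0) ^ (d + 4) * (2 * n + 1) ^ (d + 4) * Real.exp (ε / 2 * n) := by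
          have hexp : ((d + 4 : ℕ) : ℝ) * (ε / 2 / (d + 4) * n) = ε / 2 * n := by
            push_cast
            field_simp
          rw [← Real.exp_nat_mul (ε / 2 / (d + 4) * n), hexp]
      _ ≤ Real.exp (ε / 2 * n) * Real.exp (ε / 2 * n) := by gcongr
      _ = Real.exp (ε * n) := by rw [← Real.exp_add]; congr 1; ring
  obtain ⟨h1, h2⟩ := hasDecay_positive_and hiG hiH hLG hLH hmono hanti (hd.mono hjj') hG hH
  exact ⟨⟨_, isLengthFunction_universalLength iG iH hLG.positiveLength hLH.positiveLength, key h1⟩,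
    fun hz => key (h2 hz)⟩

theorem hasSD_amalgam_of_bounded (hiG : Function.Injective iG) (hiH : Function.Injective iH)
    (hLG : IsLengthFunction LG) (hLH : IsLengthFunction LH) {j : ℕ → ℝ}
    (hd : IsDistorted (fun n => n + j n) (LG ∘ iG) (LH ∘ iH))
    (hj : j =O[atTop] (fun _ : ℕ => (1 : ℝ))) (hG : HasSDWith LG) (hH : HasSDWith LH) :
    HasSD (Amalgam iG iH) ∧
      (ZerosInAmalgam iG iH LG LH → HasSDWith (universalLength iG iH LG LH)) := by
  obtain ⟨f, hf, hG⟩ := hG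
  obtain ⟨f', hf', hH⟩ := hH
  obtain ⟨C, hC⟩ := hj.bound
  obtain ⟨C', hC0, hC'⟩ := exists_forall_le_add (j := j) (g := fun _ => C)
    (hC.mono fun n hn => (le_abs_self _).trans (by simpa using hn))
  set k := |C| + C' with hk
  have hk0 : 0 ≤ k := by positivity
  have hjk : ∀ n, j n ≤ k := fun n => (hC' n).trans (by rw [hk]; gcongr; exact le_abs_self C)
  have hanti : AntitoneOn (fun n : ℕ => k / n) (Set.Ici 1) := by
    intro m hm n _ hmn
    have hm0 : (0 : ℝ) < m := by exact_mod_cast Set.mem_Ici.1 hm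
    have hmn' : (m : ℝ) ≤ n := by exact_mod_cast hmn
    dsimp only
    gcongr
  have key : ∀ {l : Amalgam iG iH → ℕ}, HasDecay l
      (fun n => decayTilde (fun n => max (f n) (f' n)) (n * Real.exp k)) → HasSDWith l := by
    intro l hl
    refine hasSDWith_of_eventually_le hl fun ε hε => ?_
    -- The decay functions are evaluated at radius at most 2n exp(k), so this rate yields exp(εn/2).
    -- Only a linear rescaling of the radius is thus harmless for subexponential f, which is where
    -- bounded j enters.
    have hδ : 0 < ε / 2 / (2 * Real.exp k) := by positivity
    have htend : Tendsto (fun n : ℕ => ⌊2 * ((n : ℝ) * Real.exp k)⌋₊) atTop atTop :=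
      tendsto_nat_floor_atTop.comp ((tendsto_natCast_atTop_atTop.atTop_mul_const
        (Real.exp_pos k)).const_mul_atTop two_pos)
    filter_upwards [eventually_mul_pow_le_exp (Real.exp k ^ 4) 4 (half_pos hε),
      htend.eventually (hf.eventually_le hδ), htend.eventually (hf'.eventually_le hδ)]
      with n hn h1 h2
    have hn0 : (0 : ℝ) ≤ n := n.cast_nonneg
    have h3 : (⌊2 * ((n : ℝ) * Real.exp k)⌋₊ : ℝ) ≤ 2 * (n * Real.exp k) :=
      Nat.floor_le (by positivity)
    have h4 : 2 * (n * Real.exp k) + 1 ≤ (2 * n + 1) * Real.exp k := by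
      linarith [Real.one_le_exp hk0]
    refine (decayTilde_le _ (by positivity) (le_max_of_le_left (hf.1 _))).trans ?_
    calc (2 * (n * Real.exp k) + 1) ^ 4 * max (f ⌊2 * ((n : ℝ) * Real.exp k)⌋₊)
            (f' ⌊2 * ((n : ℝ) * Real.exp k)⌋₊)
        ≤ ((2 * n + 1) * Real.exp k) ^ 4 *
            Real.exp (ε / 2 / (2 * Real.exp k) * (2 * (n * Real.exp k))) := by
          gcongr
          · exact le_max_of_le_left (hf.1 _)
          exact (max_le h1 h2).trans (by gcongr)
      _ = Real.exp k ^ 4 * (2 * n + 1) ^ 4 * Real.exp (ε / 2 * n) := by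
          rw [mul_pow, mul_comm ((2 * (n : ℝ) + 1) ^ 4)]
          congr 2
          field_simp
      _ ≤ Real.exp (ε / 2 * n) * Real.exp (ε / 2 * n) := by gcongr
      _ = Real.exp (ε * n) := by rw [← Real.exp_add]; congr 1; ring
  obtain ⟨h1, h2⟩ := hasDecay_positive_and hiG hiH hLG hLH (j := fun _ => k) monotone_const hanti
    (hd.mono hjk) (hG.mono fun n => le_max_left (f n) (f' n))
    (hH.mono fun n => le_max_right (f n) (f' n))
  exact ⟨⟨_, isLengthFunction_universalLength iG iH hLG.positiveLength hLH.positiveLength, key h1⟩,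
    fun hz => key (h2 hz)⟩

end Distortion

theorem mainTheorem4 {A : Type v} {G H : Type u} [Group A] [Group G] [Group H]
    (iG : A →* G) (iH : A →* H)
    (hiG : Function.Injective iG) (hiH : Function.Injective iH)
    (LG : G → ℕ) (LH : H → ℕ) (hLG : IsLengthFunction LG) (hLH : IsLengthFunction LH) :
    -- the universal length function is a length function
    IsLengthFunction (universalLength iG iH LG LH) ∧
    -- the general estimate
    (ZerosInAmalgam iG iH LG LH →
      ∀ f j : ℕ → ℝ, Monotone j → AntitoneOn (fun n : ℕ => j n / n) (Set.Ici 1) →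
        IsDistorted (fun n => n + j n) (LG ∘ iG) (LH ∘ iH) →
        HasDecay LG f → HasDecay LH f →
        HasDecay (universalLength iG iH LG LH)
          (fun n => decayTilde f (n * Real.exp (j n)))) ∧
    -- the three special cases
    (∀ j : ℕ → ℝ, IsDistorted (fun n => n + j n) (LG ∘ iG) (LH ∘ iH) →
      (j =O[atTop] (fun n : ℕ => Real.log n) → HasRDWith LG → HasRDWith LH →
        HasRD (Amalgam iG iH) ∧
          (ZerosInAmalgam iG iH LG LH → HasRDWith (universalLength iG iH LG LH))) ∧
      (j =o[atTop] (fun n : ℕ => (n : ℝ)) → HasRDWith LG → HasRDWith LH →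
        HasSD (Amalgam iG iH) ∧
          (ZerosInAmalgam iG iH LG LH → HasSDWith (universalLength iG iH LG LH))) ∧
      (j =O[atTop] (fun _ : ℕ => (1 : ℝ)) → HasSDWith LG → HasSDWith LH →
        HasSD (Amalgam iG iH) ∧
          (ZerosInAmalgam iG iH LG LH → HasSDWith (universalLength iG iH LG LH)))) := by
  exact ⟨isLengthFunction_universalLength iG iH hLG hLH,
    fun hz _ _ hj hj' hd hG hH => universalLength_hasDecay hiG hiH hLG hLH hz hj hj' hd hG hH,
    fun _ hd => ⟨hasRD_amalgam hiG hiH hLG hLH hd, hasSD_amalgam_of_sublinear hiG hiH hLG hLH hd,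
      hasSD_amalgam_of_bounded hiG hiH hLG hLH hd⟩⟩
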